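/- **Quasifolds.** An $n$-dimensional quasifold is a topological space $X$ together with an atlas of charts $\phi_i:\tilde U_i/\Gamma_i\to X$, where $\tilde U_i$ is a smooth $n$-manifold (Hausdorff, second countable), $\Gamma_i$ is a countable discrete group acting on $\tilde U_i$ by diffeomorphisms such that the points with trivial stabilizer are dense (this holds in particular if the set where the action is not free has codimension $\ge 2$), and $\phi_i$ is a homeomorphism onto an open subset of $X$; these open subsets cover $X$, and on overlaps the changes of charts $\phi_j^{-1}\circ\phi_i$ lift locally to diffeomorphisms between open subsets of $\tilde U_i$ and $\tilde U_j$. A map $f:X\to Y$ of quasifolds is smooth if, locally in charts, it lifts to smooth maps $\tilde U_i\supseteq U\to\tilde V_j$. The product $X\times\mathbb R$ is a quasifold with charts $(\tilde U_i\times\mathbb R)/\Gamma_i$, where $\Gamma_i$ acts trivially on $\mathbb R$. Smooth maps $f,g:X\to Y$ are homotopic if there is a smooth $H:X\times\mathbb R\to Y$ with $H(\cdot,0)=f$ and $H(\cdot,1)=g$. A smooth map $f:X\to Y$ is a smooth homotopy equivalence if there is a smooth $g:Y\to X$ with $g\circ f$ and $f\circ g$ homotopic to the identities; $X$ and $Y$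 have the same smooth homotopy type if such an $f$ exists. **De Rham cohomology.** A $k$-form $\alpha\in\Omega^k(X)$ is a family of smooth $k$-forms $\tilde\alpha_i$ on the manifolds $\tilde U_i$, each $\tilde\alpha_i$ invariant under $\Gamma_i$, such that $h^*\tilde\alpha_j=\tilde\alpha_i$ for every local diffeomorphism $h$ lifting a change of charts. The differential $d\alpha$ is the family $(d\tilde\alpha_i)_i$, and $H^k(X)=\{\text{closed forms in }\Omega^k(X)\}/\{\text{exact forms in }\Omega^k(X)\}$. **Proposition.** Let $X$ and $Y$ be quasifolds. 1. (Poincaré lemma) The projection $\pi:X\times\mathbb R\to X$ is smooth, and for every $k\ge 0$ pullback along $\pi$ induces an isomorphism $H^k(X)\cong H^k(X\times\mathbb R)$. 2. If $f:X\to Y$ is a smooth homotopy equivalence, then for every $k\ge0$ pullback along $f$ (defined by pulling back along the local lifts of $f$) induces an isomorphism $H^k(Y)\cong H^k(X)$. 3. In particular, if $X$ and $Y$ have the same smooth homotopy type, then $H^k(X)\cong H^k(Y)$ as real vector spaces for every $k\ge0$. -/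

import Mathlib

open Set Topology
open scoped ContDiff Manifold

noncomputable section

/-! ### Differential forms on smooth manifolds, in charts -/

section ManifoldForms

variable {E F : Type*} [NormedAddCommGroup E] [NormedSpace ℝ E]
  [NormedAddCommGroup F] [NormedSpace ℝ F]

/-- A family of (not yet compatible, not yet smooth) differential `k`-forms,
one on the image of each chart of the manifold `M` modelled on `E`. -/
abbrev FormFamily (E : Type*) [NormedAddCommGroup E] [NormedSpace ℝ E]
    (M : Type*) [TopologicalSpace M] [ChartedSpace E M] (k : ℕ) : Type _ :=
  atlas E M → E → E [⋀^Fin k]→L[ℝ] ℝ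

variable {M N : Type*} [TopologicalSpace M] [ChartedSpace E M]
  [TopologicalSpace N] [ChartedSpace F N]

/-- `PullsBackOn f U α η`: over the set `U` one has `η = f^* α`. In charts `e` of `M` and `e'` of `N`
this is the usual formula `η_e (y) = α_{e'} (g y) ∘ (Dg_y × ⋯ × Dg_y)` with `g = e' ∘ f ∘ e⁻¹`. -/
def PullsBackOn {k : ℕ} (f : M → N) (U : Set M) (α : FormFamily F N k) (η : FormFamily E M k) :
    Prop :=
  ∀ (e : atlas E M) (e' : atlas F N), ∀ y ∈ e.1.target, e.1.symm y ∈ U →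
    f (e.1.symm y) ∈ e'.1.source →
    η e y = (α e' (e'.1 (f (e.1.symm y)))).compContinuousLinearMap
      (fderiv ℝ (fun z => e'.1 (f (e.1.symm z))) y)

theorem PullsBackOn.zero {k : ℕ} (f : M → N) (U : Set M) :
    PullsBackOn f U (0 : FormFamily F N k) (0 : FormFamily E M k) :=
  fun _ _ _ _ _ _ => rfl

theorem PullsBackOn.add {k : ℕ} {f : M → N} {U : Set M} {α α' : FormFamily F N k}
    {η η' : FormFamily E M k} (h : PullsBackOn f U α η) (h' : PullsBackOn f U α' η') :
    PullsBackOn f U (α + α') (η + η') :=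
  fun e e' y hy hU hs => congrArg₂ (· + ·) (h e e' y hy hU hs) (h' e e' y hy hU hs)

theorem PullsBackOn.smul {k : ℕ} {f : M → N} {U : Set M} {α : FormFamily F N k}
    {η : FormFamily E M k} (c : ℝ) (h : PullsBackOn f U α η) :
    PullsBackOn f U (c • α) (c • η) :=
  fun e e' y hy hU hs => congrArg (c • ·) (h e e' y hy hU hs)

/-- The space `Ω^k(M)` of smooth differential `k`-forms on the manifold `M` modelled on `E`:
families of smooth forms on the images of the charts which are compatible with the
transition maps. (Outside the image of the chart the value is set to `0`.) -/
def ManifoldForm (E : Type*) [NormedAddCommGroup E] [NormedSpace ℝ E]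
    (M : Type*) [TopologicalSpace M] [ChartedSpace E M] (k : ℕ) :
    Submodule ℝ (FormFamily E M k) where
  carrier := {α | (∀ e, ContDiffOn ℝ ∞ (α e) e.1.target) ∧ (∀ e, ∀ y ∉ e.1.target, α e y = 0) ∧
    PullsBackOn (id : M → M) univ α α}
  add_mem' := by
    rintro a b ⟨ha, ha0, hac⟩ ⟨hb, hb0, hbc⟩
    exact ⟨fun e => (ha e).add (hb e), fun e y hy => by simp [ha0 e y hy, hb0 e y hy], hac.add hbc⟩
  zero_mem' := ⟨fun e => contDiffOn_const, fun e y hy => rfl, .zero _ _⟩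
  smul_mem' := by
    rintro c a ⟨ha, ha0, hac⟩
    exact ⟨fun e => (ha e).const_smul c, fun e y hy => by simp [ha0 e y hy], hac.smul c⟩

open Classical in
/-- The exterior derivative of a family of forms, chart by chart. -/
def FormFamily.d {k : ℕ} (α : FormFamily E M k) : FormFamily E M (k + 1) :=
  fun e y => if y ∈ e.1.target then extDeriv (α e) y else 0

/-- The exterior derivative commutes with pullback along smooth maps. -/
theorem PullsBackOn.d [IsManifold 𝓘(ℝ, E) ∞ M] [IsManifold 𝓘(ℝ, F) ∞ N] {k : ℕ} {f : M → N}
    {U : Set M} (hU : IsOpen U) (hf : ContMDiffOn 𝓘(ℝ, E) 𝓘(ℝ, F) ∞ f U)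
    {α : FormFamily F N k} {η : FormFamily E M k}
    (hα : ∀ e, ContDiffOn ℝ ∞ (α e) e.1.target) (h : PullsBackOn f U α η) :
    PullsBackOn f U α.d η.d := by
  intro e e' y hy hyU hys
  have hms : e'.1 (f (e.1.symm y)) ∈ e'.1.target := e'.1.map_source hys
  simp only [FormFamily.d, hy, hms, if_true]
  have hec : ContinuousAt e.1.symm y := e.1.continuousAt_symm hy
  have hfc : ContinuousAt f (e.1.symm y) := (hf.continuousOn).continuousAt (hU.mem_nhds hyU)
  have hsm : ContDiffAt ℝ ∞ (fun z => e'.1 (f (e.1.symm z))) y := by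
    rw [← contMDiffAt_iff_contDiffAt]
    have h1 : ContMDiffAt 𝓘(ℝ, E) 𝓘(ℝ, E) ∞ e.1.symm y :=
      (contMDiffOn_symm_of_mem_maximalAtlas
        (IsManifold.subset_maximalAtlas e.2)).contMDiffAt (e.1.open_target.mem_nhds hy)
    have h2 : ContMDiffAt 𝓘(ℝ, E) 𝓘(ℝ, F) ∞ f (e.1.symm y) :=
      hf.contMDiffAt (hU.mem_nhds hyU)
    have h3 : ContMDiffAt 𝓘(ℝ, F) 𝓘(ℝ, F) ∞ e'.1 (f (e.1.symm y)) :=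
      (contMDiffOn_of_mem_maximalAtlas
        (IsManifold.subset_maximalAtlas e'.2)).contMDiffAt (e'.1.open_source.mem_nhds hys)
    exact h3.comp y (h2.comp y h1)
  have hev : η e =ᶠ[𝓝 y] fun z => (α e' (e'.1 (f (e.1.symm z)))).compContinuousLinearMap
      (fderiv ℝ (fun w => e'.1 (f (e.1.symm w))) z) := by
    filter_upwards [e.1.open_target.mem_nhds hy, hec.preimage_mem_nhds (hU.mem_nhds hyU),
      (hfc.comp hec).preimage_mem_nhds (e'.1.open_source.mem_nhds hys)] with z h1 h2 h3
    exact h e e' z h1 h2 h3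
  rw [hev.extDeriv_eq]
  refine extDeriv_pullback (f := fun z => e'.1 (f (e.1.symm z))) (r := ∞) ?_ hsm ?_
  · exact ((hα e').contDiffAt (e'.1.open_target.mem_nhds hms)).differentiableAt (by simp)
  · rw [minSmoothness_of_isRCLikeNormedField]
    exact WithTop.coe_le_coe.2 le_top

theorem FormFamily.d_contDiffOn {k : ℕ} {α : FormFamily E M k}
    (hα : ∀ e, ContDiffOn ℝ ∞ (α e) e.1.target) (e : atlas E M) :
    ContDiffOn ℝ ∞ (α.d e) e.1.target := by
  have h : ContDiffOn ℝ ∞ (extDeriv (α e)) e.1.target :=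
    (ContinuousAlternatingMap.alternatizeUncurryFinCLM ℝ E ℝ).contDiff.comp_contDiffOn
      ((hα e).fderiv_of_isOpen e.1.open_target (by simp))
  exact h.congr fun y hy => by simp [FormFamily.d, hy]

/-- The exterior derivative maps `Ω^k(M)` to `Ω^{k+1}(M)`. -/
theorem FormFamily.d_mem [IsManifold 𝓘(ℝ, E) ∞ M] {k : ℕ} {α : FormFamily E M k}
    (hα : α ∈ ManifoldForm E M k) : α.d ∈ ManifoldForm E M (k + 1) :=
  ⟨FormFamily.d_contDiffOn hα.1, fun e y hy => by simp [FormFamily.d, hy],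
    PullsBackOn.d isOpen_univ contMDiffOn_id hα.1 hα.2.2⟩

theorem FormFamily.d_add {k : ℕ} {a b : FormFamily E M k}
    (ha : a ∈ ManifoldForm E M k) (hb : b ∈ ManifoldForm E M k) : (a + b).d = a.d + b.d := by
  funext e y
  by_cases hy : y ∈ e.1.target
  · have ha := ((ha.1 e).contDiffAt (e.1.open_target.mem_nhds hy)).differentiableAt (by simp)
    have hb := ((hb.1 e).contDiffAt (e.1.open_target.mem_nhds hy)).differentiableAt (by simp)
    simpa [FormFamily.d, hy] using extDeriv_add ha hb
  · simp [FormFamily.d, hy]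

theorem FormFamily.d_smul {k : ℕ} (c : ℝ) (a : FormFamily E M k) : (c • a).d = c • a.d := by
  funext e y
  by_cases hy : y ∈ e.1.target
  · simpa [FormFamily.d, hy] using extDeriv_smul c (a e)
  · simp [FormFamily.d, hy]

theorem FormFamily.d_d {k : ℕ} {α : FormFamily E M k} (hα : α ∈ ManifoldForm E M k) :
    α.d.d = 0 := by
  funext e y
  by_cases hy : y ∈ e.1.target
  · have h1 : (α.d e) =ᶠ[𝓝 y] extDeriv (α e) := by
      filter_upwards [e.1.open_target.mem_nhds hy] with z hz
      simp [FormFamily.d, hz]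
    have h2 : extDeriv (extDeriv (α e)) y = 0 :=
      extDeriv_extDeriv_apply (r := ∞)
        ((hα.1 e).contDiffAt (e.1.open_target.mem_nhds hy))
        (by rw [minSmoothness_of_isRCLikeNormedField]; exact WithTop.coe_le_coe.2 le_top)
    rw [FormFamily.d, if_pos hy, h1.extDeriv_eq, h2]
    rfl
  · rw [FormFamily.d, if_neg hy]
    rfl

end ManifoldForms

/-! ### Quasifolds -/

/-- A quasifold structure, modelled on the real vector space `E`, on the topological space `X`.
It is an atlas of charts `φ i : Cov i / Gp i → X`, where `Cov i` is a smooth manifold modelled on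
`E`, `Gp i` is a (countable) discrete group acting on `Cov i` by diffeomorphisms, and `φ i` is a
homeomorphism onto an open subset of `X`; these open subsets cover `X`, and on overlaps the
changes of charts lift locally to diffeomorphisms.
The set where the action is not free is required to have dense complement; this follows from any
condition that its codimension be at least `2`. -/
structure Quasifold (E : Type*) [NormedAddCommGroup E] [NormedSpace ℝ E]
    (X : Type*) [TopologicalSpace X] where
  /-- the index set of the atlas -/
  Idx : Type*
  /-- the manifold upstairs -/
  Cov : Idx → Type*
  [topCov : ∀ i, TopologicalSpace (Cov i)]
  [t2Cov : ∀ i, T2Space (Cov i)]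
  [secondCov : ∀ i, SecondCountableTopology (Cov i)]
  [chartedCov : ∀ i, ChartedSpace E (Cov i)]
  [manifoldCov : ∀ i, IsManifold 𝓘(ℝ, E) ∞ (Cov i)]
  /-- the discrete group acting on the manifold upstairs -/
  Gp : Idx → Type*
  [groupGp : ∀ i, Group (Gp i)]
  [countableGp : ∀ i, Countable (Gp i)]
  [actGp : ∀ i, MulAction (Gp i) (Cov i)]
  smooth_smul : ∀ i (γ : Gp i), ContMDiff 𝓘(ℝ, E) 𝓘(ℝ, E) ∞ (fun x : Cov i => γ • x)
  dense_free : ∀ i, Dense {x : Cov i | ∀ γ : Gp i, γ • x = x → γ = 1}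
  /-- the chart maps -/
  φ : ∀ i, Quotient (MulAction.orbitRel (Gp i) (Cov i)) → X
  isOpenEmbedding_φ : ∀ i, IsOpenEmbedding (φ i)
  cover : ∀ p : X, ∃ i, p ∈ range (φ i)
  change : ∀ i j (x : Cov i), φ i (Quotient.mk _ x) ∈ range (φ j) →
    ∃ h : OpenPartialHomeomorph (Cov i) (Cov j), x ∈ h.source ∧
      ContMDiffOn 𝓘(ℝ, E) 𝓘(ℝ, E) ∞ h h.source ∧
      ContMDiffOn 𝓘(ℝ, E) 𝓘(ℝ, E) ∞ h.symm h.target ∧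
      ∀ z ∈ h.source, φ j (Quotient.mk _ (h z)) = φ i (Quotient.mk _ z)

attribute [instance] Quasifold.topCov Quasifold.t2Cov Quasifold.secondCov Quasifold.chartedCov
  Quasifold.manifoldCov Quasifold.groupGp Quasifold.countableGp Quasifold.actGp

namespace Quasifold

variable {E F : Type*} [NormedAddCommGroup E] [NormedSpace ℝ E]
  [NormedAddCommGroup F] [NormedSpace ℝ F]
  {X Y : Type*} [TopologicalSpace X] [TopologicalSpace Y]

/-- The composite `Cov i → Cov i / Gp i → X`. -/
def proj (Q : Quasifold E X) (i : Q.Idx) (x : Q.Cov i) : X := Q.φ i (Quotient.mk _ x)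

/-- `h`, restricted to the open set `U ⊆ Q.Cov i`, is a local smooth lift of `f : X → Y`. -/
structure IsLocalLift (Q : Quasifold E X) (R : Quasifold F Y) (f : X → Y) (i : Q.Idx) (j : R.Idx)
    (U : Set (Q.Cov i)) (h : Q.Cov i → R.Cov j) : Prop where
  isOpen : IsOpen U
  smooth : ContMDiffOn 𝓘(ℝ, E) 𝓘(ℝ, F) ∞ h U
  lift : ∀ z ∈ U, R.proj j (h z) = f (Q.proj i z)

/-- A map of quasifolds is smooth if locally in charts it lifts to smooth maps of manifolds. -/
def IsSmooth (Q : Quasifold E X) (R : Quasifold F Y) (f : X → Y) : Prop :=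
  ∀ (i : Q.Idx) (x : Q.Cov i), ∃ (j : R.Idx) (U : Set (Q.Cov i)) (h : Q.Cov i → R.Cov j),
    x ∈ U ∧ IsLocalLift Q R f i j U h

/-! #### Differential forms and de Rham cohomology -/

/-- Families of (not yet compatible) differential `k`-forms on the manifolds `Q.Cov i`. -/
def FormTuple (Q : Quasifold E X) (k : ℕ) : Type _ := ∀ i, FormFamily E (Q.Cov i) k

instance (Q : Quasifold E X) (k : ℕ) : AddCommGroup (Q.FormTuple k) :=
  inferInstanceAs (AddCommGroup (∀ i, FormFamily E (Q.Cov i) k))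

instance (Q : Quasifold E X) (k : ℕ) : Module ℝ (Q.FormTuple k) :=
  inferInstanceAs (Module ℝ (∀ i, FormFamily E (Q.Cov i) k))

/-- The space `Ω^k` of differential `k`-forms on a quasifold: a `k`-form on each manifold
`Q.Cov i`, invariant under the group `Q.Gp i`, such that these forms correspond to each other under
(local lifts of) changes of charts. -/
def Form (Q : Quasifold E X) (k : ℕ) : Submodule ℝ (Q.FormTuple k) where
  carrier := {α | (∀ i, α i ∈ ManifoldForm E (Q.Cov i) k) ∧
    (∀ i (γ : Q.Gp i), PullsBackOn (fun x : Q.Cov i => γ • x) univ (α i) (α i)) ∧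
    ∀ (i j : Q.Idx) (h : OpenPartialHomeomorph (Q.Cov i) (Q.Cov j)),
      ContMDiffOn 𝓘(ℝ, E) 𝓘(ℝ, E) ∞ h h.source →
      ContMDiffOn 𝓘(ℝ, E) 𝓘(ℝ, E) ∞ h.symm h.target →
      (∀ z ∈ h.source, Q.proj j (h z) = Q.proj i z) →
      PullsBackOn h h.source (α j) (α i)}
  add_mem' := by
    rintro a b ⟨ha0, ha, ha'⟩ ⟨hb0, hb, hb'⟩
    exact ⟨fun i => add_mem (ha0 i) (hb0 i), fun i γ => (ha i γ).add (hb i γ),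
      fun i j h h1 h2 h3 => (ha' i j h h1 h2 h3).add (hb' i j h h1 h2 h3)⟩
  zero_mem' := ⟨fun i => zero_mem _, fun i γ => PullsBackOn.zero _ _,
    fun i j h h1 h2 h3 => PullsBackOn.zero _ _⟩
  smul_mem' := by
    rintro c a ⟨ha0, ha, ha'⟩
    exact ⟨fun i => Submodule.smul_mem _ c (ha0 i), fun i γ => (ha i γ).smul c,
      fun i j h h1 h2 h3 => (ha' i j h h1 h2 h3).smul c⟩

/-- The exterior derivative `d : Ω^k → Ω^{k+1}`, given locally by the exterior derivatives on the
manifolds `Q.Cov i`. -/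
def d (Q : Quasifold E X) (k : ℕ) : Q.Form k →ₗ[ℝ] Q.Form (k + 1) where
  toFun α := ⟨fun i => (α.1 i).d, fun i => FormFamily.d_mem (α.2.1 i),
    fun i γ => PullsBackOn.d isOpen_univ (Q.smooth_smul i γ).contMDiffOn (α.2.1 i).1 (α.2.2.1 i γ),
    fun i j h h1 h2 h3 => PullsBackOn.d h.open_source h1 (α.2.1 j).1 (α.2.2.2 i j h h1 h2 h3)⟩
  map_add' a b := by
    ext1
    funext i
    exact FormFamily.d_add (a.2.1 i) (b.2.1 i)
  map_smul' c a := by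
    ext1
    funext i
    exact FormFamily.d_smul c (a.1 i)

theorem d_d (Q : Quasifold E X) (k : ℕ) (α : Q.Form k) : Q.d (k + 1) (Q.d k α) = 0 := by
  ext1
  funext i
  exact FormFamily.d_d (α.2.1 i)

/-- The closed `k`-forms. -/
def Closed (Q : Quasifold E X) (k : ℕ) : Submodule ℝ (Q.Form k) := LinearMap.ker (Q.d k)

/-- The exact `k`-forms (only `0` in degree `0`). -/
def Exact (Q : Quasifold E X) : ∀ k : ℕ, Submodule ℝ (Q.Form k)
  | 0 => ⊥
  | k + 1 => LinearMap.range (Q.d k)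

/-- The de Rham cohomology `H^k = {closed k-forms} / {exact k-forms}`. -/
abbrev DeRham (Q : Quasifold E X) (k : ℕ) : Type _ :=
  Q.Closed k ⧸ (Q.Exact k).submoduleOf (Q.Closed k)

/-- The cohomology class of a closed form. -/
def cls (Q : Quasifold E X) (k : ℕ) : Q.Closed k →ₗ[ℝ] Q.DeRham k :=
  ((Q.Exact k).submoduleOf (Q.Closed k)).mkQ

/-- `η = f^* α`: for each local smooth lift `h` of `f`, the form `η` is locally given by the
pullback along `h` of the local expression of `α`. -/
def IsPullback (Q : Quasifold E X) (R : Quasifold F Y) (f : X → Y) {k : ℕ}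
    (α : R.Form k) (η : Q.Form k) : Prop :=
  ∀ (i : Q.Idx) (j : R.Idx) (U : Set (Q.Cov i)) (h : Q.Cov i → R.Cov j),
    IsLocalLift Q R f i j U h → PullsBackOn h U (α.1 j) (η.1 i)

/-- Pullback of closed forms along the smooth map `f : X → Y` is defined and induces an
isomorphism `H^k(Y) ≅ H^k(X)`. -/
def PullbackIsIso (Q : Quasifold E X) (R : Quasifold F Y) (f : X → Y) (k : ℕ) : Prop :=
  ∃ Φ : R.DeRham k ≃ₗ[ℝ] Q.DeRham k, ∀ α : R.Closed k, ∃ η : Q.Closed k,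
    IsPullback Q R f α.1 η.1 ∧ Φ (R.cls k α) = Q.cls k η

/-! #### The product of a quasifold with the real line -/

/-- The action of `Γ` on `M × ℝ` through the first factor. -/
@[reducible] def prodRealAction (Γ M : Type*) [Group Γ] [MulAction Γ M] :
    MulAction Γ (M × ℝ) where
  smul γ p := (γ • p.1, p.2)
  one_smul p := Prod.ext (one_smul Γ p.1) rfl
  mul_smul γ δ p := Prod.ext (mul_smul γ δ p.1) rfl

/-- The chart `(M × ℝ) / Γ → X × ℝ`, `[(x, t)] ↦ (c [x], t)`, induced by a chart `c : M / Γ → X`. -/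
def prodRealChart (Γ M : Type*) [Group Γ] [MulAction Γ M]
    (c : Quotient (MulAction.orbitRel Γ M) → X) :
    Quotient (@MulAction.orbitRel Γ (M × ℝ) _ (prodRealAction Γ M)) → X × ℝ :=
  Quotient.lift (s := @MulAction.orbitRel Γ (M × ℝ) _ (prodRealAction Γ M))
    (fun p => (c (Quotient.mk _ p.1), p.2)) (by
      rintro p q ⟨γ, hγ⟩
      obtain ⟨h1, h2⟩ := Prod.ext_iff.1 (show ((γ • q.1, q.2) : M × ℝ) = p from hγ)
      change q.2 = p.2 at h2
      have h3 : (Quotient.mk (MulAction.orbitRel Γ M) p.1) = Quotient.mk _ q.1 :=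
        Quotient.sound ⟨γ, h1⟩
      simp only [h3, h2])

theorem isOpenEmbedding_prodRealChart (Γ M : Type*) [Group Γ] [TopologicalSpace M] [MulAction Γ M]
    [ContinuousConstSMul Γ M] {c : Quotient (MulAction.orbitRel Γ M) → X}
    (hc : IsOpenEmbedding c) : IsOpenEmbedding (prodRealChart Γ M c) := by
  let s := @MulAction.orbitRel Γ (M × ℝ) _ (prodRealAction Γ M)
  have hq : IsOpenQuotientMap (Quotient.mk (MulAction.orbitRel Γ M)) :=
    MulAction.isOpenQuotientMap_quotientMk
  refine .of_continuous_injective_isOpenMap ?_ ?_ ?_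
  · refine Continuous.quotient_lift (s := s) ?_ _
    exact ((hc.continuous.comp hq.continuous).comp continuous_fst).prodMk continuous_snd
  · intro a b
    refine Quotient.inductionOn₂ a b fun p q h => ?_
    have h1 := hc.injective (congrArg (Prod.fst : X × ℝ → X) h)
    have h2 : p.2 = q.2 := congrArg (Prod.snd : X × ℝ → ℝ) h
    obtain ⟨γ, hγ⟩ := Quotient.exact h1
    exact Quotient.sound ⟨γ, Prod.ext hγ h2.symm⟩
  · have ho : IsOpenMap fun p : M × ℝ => (c (Quotient.mk _ p.1), p.2) :=
      (hc.isOpenMap.comp hq.isOpenMap).prodMap IsOpenMap.id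
    intro V hV
    have : prodRealChart Γ M c '' V =
        (fun p : M × ℝ => (c (Quotient.mk _ p.1), p.2)) '' (Quotient.mk s ⁻¹' V) := by
      ext z
      constructor
      · rintro ⟨a, ha, rfl⟩
        induction a using Quotient.inductionOn with
        | h p => exact ⟨p, ha, rfl⟩
      · rintro ⟨p, hp, rfl⟩
        exact ⟨Quotient.mk s p, hp, rfl⟩
    rw [this]
    exact ho _ (hV.preimage continuous_quotient_mk')

theorem continuousConstSMul (Q : Quasifold E X) (i : Q.Idx) :
    ContinuousConstSMul (Q.Gp i) (Q.Cov i) :=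
  ⟨fun γ => (Q.smooth_smul i γ).continuous⟩

/-- The natural quasifold structure on `X × ℝ`: its charts are `(Cov i × ℝ) / Gp i`, with `Gp i`
acting trivially on the second factor. -/
@[reducible] def prodReal (Q : Quasifold E X) : Quasifold (E × ℝ) (X × ℝ) where
  Idx := Q.Idx
  Cov i := Q.Cov i × ℝ
  chartedCov i := prodChartedSpace E (Q.Cov i) ℝ ℝ
  manifoldCov i := by
    rw [modelWithCornersSelf_prod]
    exact IsManifold.prod (Q.Cov i) ℝ
  Gp := Q.Gp
  actGp i := prodRealAction (Q.Gp i) (Q.Cov i)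
  smooth_smul i γ := by
    rw [modelWithCornersSelf_prod]
    exact (Q.smooth_smul i γ).prodMap contMDiff_id
  dense_free i := by
    have h := (Q.dense_free i).prod (dense_univ (X := ℝ))
    refine h.mono ?_
    rintro p ⟨hp, -⟩ γ hγ
    exact hp γ (congrArg Prod.fst hγ)
  φ i := prodRealChart (Q.Gp i) (Q.Cov i) (Q.φ i)
  isOpenEmbedding_φ i :=
    haveI := Q.continuousConstSMul i
    isOpenEmbedding_prodRealChart (Q.Gp i) (Q.Cov i) (Q.isOpenEmbedding_φ i)
  cover p := by
    obtain ⟨i, a, ha⟩ := Q.cover p.1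
    induction a using Quotient.inductionOn with
    | h x =>
      exact ⟨i, Quotient.mk _ (x, p.2), Prod.ext ha rfl⟩
  change i j p hp := by
    obtain ⟨b, hb⟩ := hp
    have hp' : Q.φ i (Quotient.mk _ p.1) ∈ range (Q.φ j) := by
      induction b using Quotient.inductionOn with
      | h q => exact ⟨Quotient.mk _ q.1, congrArg Prod.fst hb⟩
    obtain ⟨h, h1, h2, h3, h4⟩ := Q.change i j p.1 hp'
    refine ⟨h.prod (OpenPartialHomeomorph.refl ℝ), ⟨h1, mem_univ _⟩, ?_, ?_, ?_⟩
    · rw [modelWithCornersSelf_prod]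
      exact h2.prodMap contMDiffOn_id
    · rw [modelWithCornersSelf_prod]
      exact h3.prodMap contMDiffOn_id
    · rintro z ⟨hz, -⟩
      exact Prod.ext (h4 z.1 hz) rfl

/-! #### Smooth homotopy -/

/-- Two maps `f g : X → Y` are smoothly homotopic if there is a smooth map `H : X × ℝ → Y` with
`H (·, 0) = f` and `H (·, 1) = g`. -/
def SmoothHomotopic (Q : Quasifold E X) (R : Quasifold F Y) (f g : X → Y) : Prop :=
  ∃ H : X × ℝ → Y, IsSmooth Q.prodReal R H ∧ (∀ p, H (p, 0) = f p) ∧ ∀ p, H (p, 1) = g p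

/-- `f : X → Y` is a smooth homotopy equivalence. -/
def IsSmoothHomotopyEquiv (Q : Quasifold E X) (R : Quasifold F Y) (f : X → Y) : Prop :=
  IsSmooth Q R f ∧ ∃ g : Y → X, IsSmooth R Q g ∧
    SmoothHomotopic Q Q (g ∘ f) id ∧ SmoothHomotopic R R (f ∘ g) id

/-- `X` and `Y` have the same smooth homotopy type. -/
def SameSmoothHomotopyType (Q : Quasifold E X) (R : Quasifold F Y) : Prop :=
  ∃ f : X → Y, IsSmoothHomotopyEquiv Q R f

end Quasifold

end

/-! A smooth map has many local lifts, and the first task is to show that all of them pull a form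
back to the same form. Two lifts into one chart agree in the quotient, so at each point they differ
by a group element, which may jump from point to point. Since the group is countable and the source
is a Baire space, every nonempty open set contains a smaller one on which a single element works
(`exists_isOpen_eq_smul`). There, invariance of the form makes the two pullbacks equal, and
continuity extends the equality from a dense set (`eq_of_isLocalLift_same`). Lifts into different
charts are compared through a change of charts (`eq_of_isLocalLift`). Pullback is therefore a
well-defined linear map commuting with `d`, and its characterization by local lifts gives
functoriality in cohomology.

Homotopy invariance is then the classical argument. Contracting a form on `X × ℝ` with ∂/∂t and
integrating over `[0, 1]` gives a form on `X`, because the maps `m × id` preserve t and ∂/∂t. If η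
is closed of positive degree, Cartan's formula and the fundamental theorem of calculus show that d
of this integral is η|₁ - η|₀ (`extDeriv_integral_contractTime`); a closed 0-form is constant in t.
Hence the slices at 0 and 1 induce the same map in cohomology (`pullbackDeRham_slice`), so do any
two homotopic maps, and homotopy equivalences induce isomorphisms. The Poincaré lemma is the case of
the projection, whose homotopy inverse is the zero slice. -/

noncomputable section

/-! ### Calculus of alternating forms on normed spaces. -/

section Calculus

open MeasureTheory

universe u v

/-- Alternatization of continuous multilinear maps, as a continuous linear map. -/
def ContinuousMultilinearMap.alternatizationCLM (E : Type*) [NormedAddCommGroup E]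
    [NormedSpace ℝ E] (k : ℕ) :
    ContinuousMultilinearMap ℝ (fun _ : Fin k => E) ℝ →L[ℝ] E [⋀^Fin k]→L[ℝ] ℝ :=
  LinearMap.mkContinuous
    { toFun := fun f => ContinuousMultilinearMap.alternatization f
      map_add' := fun f g => map_add _ f g
      map_smul' := fun c f => by
        ext v
        simp [ContinuousMultilinearMap.alternatization_apply_apply, Finset.mul_sum,
          mul_smul_comm] }
    (Fintype.card (Equiv.Perm (Fin k)) : ℝ) (by
      intro f
      refine ContinuousAlternatingMap.opNorm_le_bound _ (by positivity) fun v => ?_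
      change ‖ContinuousMultilinearMap.alternatization f v‖ ≤ _
      rw [ContinuousMultilinearMap.alternatization_apply_apply]
      refine (norm_sum_le _ _).trans ?_
      rw [mul_assoc, ← Finset.card_univ, ← nsmul_eq_mul]
      refine Finset.sum_le_card_nsmul _ _ _ fun σ _ => ?_
      have h1 : ‖Equiv.Perm.sign σ • f (v ∘ σ)‖ = ‖f (v ∘ σ)‖ := by
        rcases Int.units_eq_one_or (Equiv.Perm.sign σ) with h | h <;> simp [h]
      rw [h1]
      refine (f.le_opNorm _).trans (le_of_eq ?_)
      congr 1
      exact Equiv.prod_comp σ fun i => ‖v i‖)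

/-- Each of the `k!` signed permutations of an alternating form is the form itself. Thus
alternatization divided by `k!` is a continuous linear retraction onto alternating forms, which
transfers smoothness from multilinear to alternating maps. -/
theorem ContinuousMultilinearMap.alternatizationCLM_apply {E : Type*} [NormedAddCommGroup E]
    [NormedSpace ℝ E] {k : ℕ} (f : E [⋀^Fin k]→L[ℝ] ℝ) :
    alternatizationCLM E k f.toContinuousMultilinearMap = (k.factorial : ℝ) • f := by
  ext v
  change ContinuousMultilinearMap.alternatization _ v = _
  rw [ContinuousMultilinearMap.alternatization_apply_apply]
  have h : ∀ σ : Equiv.Perm (Fin k),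
      Equiv.Perm.sign σ • f.toContinuousMultilinearMap (v ∘ σ) = f v := by
    intro σ
    have h2 : f (v ∘ σ) = Equiv.Perm.sign σ • f v := f.toAlternatingMap.map_perm v σ
    change Equiv.Perm.sign σ • f (v ∘ σ) = f v
    rw [h2, smul_smul, Int.units_mul_self, one_smul]
  simp only [h]
  simp [Fintype.card_perm]

/-- The pullback of alternating forms along linear maps depends smoothly on both arguments. -/
theorem contDiff_compContinuousLinearMap {E F : Type*} [NormedAddCommGroup E] [NormedSpace ℝ E]
    [NormedAddCommGroup F] [NormedSpace ℝ F] (k : ℕ) :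
    ContDiff ℝ ∞ (fun p : (F [⋀^Fin k]→L[ℝ] ℝ) × (E →L[ℝ] F) =>
      p.1.compContinuousLinearMap p.2) := by
  have h1 : ContDiff ℝ ∞ (fun p : (F [⋀^Fin k]→L[ℝ] ℝ) × (E →L[ℝ] F) =>
      p.1.toContinuousMultilinearMap.compContinuousLinearMap fun _ => p.2) := by
    -- For multilinear forms, precomposition is multilinear in the `k` linear maps and linear in the
    -- form, hence smooth.
    have h2 : ContDiff ℝ ∞ (fun p : (F [⋀^Fin k]→L[ℝ] ℝ) × (E →L[ℝ] F) =>
        ContinuousMultilinearMap.compContinuousLinearMapContinuousMultilinear ℝ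
          (fun _ : Fin k => E) (fun _ : Fin k => F) ℝ (fun _ => p.2)) :=
      (ContinuousMultilinearMap.contDiff _).comp (contDiff_pi.2 fun _ => contDiff_snd)
    have h3 : ContDiff ℝ ∞ (fun p : (F [⋀^Fin k]→L[ℝ] ℝ) × (E →L[ℝ] F) =>
        p.1.toContinuousMultilinearMap) :=
      (ContinuousAlternatingMap.toContinuousMultilinearMapCLM (𝕜 := ℝ) (E := F) (F := ℝ)
        (ι := Fin k) ℝ).contDiff.comp contDiff_fst
    exact h2.clm_apply h3
  -- Apply the retraction: it fixes the pulled-back form, which is already alternating.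
  have h2 := (((k.factorial : ℝ)⁻¹) •
    ContinuousMultilinearMap.alternatizationCLM E k).contDiff.comp h1
  convert h2 using 2 with p
  have h3 := ContinuousMultilinearMap.alternatizationCLM_apply (p.1.compContinuousLinearMap p.2)
  have h4 : (k.factorial : ℝ) ≠ 0 := by positivity
  change _ = ((k.factorial : ℝ)⁻¹) • ContinuousMultilinearMap.alternatizationCLM E k
    (p.1.compContinuousLinearMap p.2).toContinuousMultilinearMap
  rw [h3, smul_smul, inv_mul_cancel₀ h4, one_smul]

theorem ContDiffOn.compContinuousLinearMap {E F G : Type*} [NormedAddCommGroup E]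
    [NormedSpace ℝ E] [NormedAddCommGroup F] [NormedSpace ℝ F] [NormedAddCommGroup G]
    [NormedSpace ℝ G] {k : ℕ} {s : Set G} {a : G → F [⋀^Fin k]→L[ℝ] ℝ} {b : G → E →L[ℝ] F}
    (ha : ContDiffOn ℝ ∞ a s) (hb : ContDiffOn ℝ ∞ b s) :
    ContDiffOn ℝ ∞ (fun x => (a x).compContinuousLinearMap (b x)) s :=
  (contDiff_compContinuousLinearMap k).comp_contDiffOn (ha.prodMk hb)

/-! ### Integrals over `[0, 1]` depending on a parameter. -/

section Parametric

variable {E : Type u} [NormedAddCommGroup E] [NormedSpace ℝ E] [FiniteDimensional ℝ E]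

/-- Differentiation under the integral sign by domination: closed balls in `E` are compact, so the
partial derivative is bounded by a constant on a small closed ball times `[0, 1]`. -/
theorem hasFDerivAt_integral_of_contDiffOn {A : Type v} [NormedAddCommGroup A] [NormedSpace ℝ A]
    {W : Set E} (hW : IsOpen W) {G : E × ℝ → A}
    (hG : ContDiffOn ℝ ∞ G (W ×ˢ univ)) {y : E} (hy : y ∈ W) :
    HasFDerivAt (fun z => ∫ t in (0 : ℝ)..1, G (z, t))
      (∫ t in (0 : ℝ)..1, (fderiv ℝ G (y, t)).comp (ContinuousLinearMap.inl ℝ E ℝ)) y := by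
  have hWo : IsOpen (W ×ˢ (univ : Set ℝ)) := hW.prod isOpen_univ
  have hG' : ContDiffOn ℝ ∞ (fderiv ℝ G) (W ×ˢ univ) := hG.fderiv_of_isOpen hWo (by simp)
  obtain ⟨r, hr, hrW⟩ := Metric.isOpen_iff.1 hW y hy
  have hcb : Metric.closedBall y (r / 2) ⊆ W :=
    (Metric.closedBall_subset_ball (by linarith)).trans hrW
  have hslice : ∀ z ∈ W, ∀ {B : Type (max u v)} [TopologicalSpace B] {g : E × ℝ → B},
      ContinuousOn g (W ×ˢ univ) → Continuous fun t => g (z, t) := by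
    intro z hz B _ g hg
    exact hg.comp_continuous (by fun_prop) fun t => ⟨hz, mem_univ t⟩
  have hslice' : ∀ z ∈ W, Continuous fun t => G (z, t) := by
    intro z hz
    exact hG.continuousOn.comp_continuous (by fun_prop) fun t => ⟨hz, mem_univ t⟩
  have hD : ContinuousOn
      (fun p => (fderiv ℝ G p).comp (ContinuousLinearMap.inl ℝ E ℝ)) (W ×ˢ univ) :=
    hG'.continuousOn.clm_comp continuousOn_const
  obtain ⟨C, hC⟩ : ∃ C, ∀ p ∈ Metric.closedBall y (r / 2) ×ˢ Icc (0 : ℝ) 1,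
      ‖(fderiv ℝ G p).comp (ContinuousLinearMap.inl ℝ E ℝ)‖ ≤ C :=
    ((isCompact_closedBall y (r / 2)).prod isCompact_Icc).exists_bound_of_continuousOn
      (hD.mono (prod_mono hcb (subset_univ _)))
  refine intervalIntegral.hasFDerivAt_integral_of_dominated_of_fderiv_le
    (F := fun z t => G (z, t))
    (F' := fun z t => (fderiv ℝ G (z, t)).comp (ContinuousLinearMap.inl ℝ E ℝ))
    (bound := fun _ => C)
    (Metric.ball_mem_nhds y (half_pos hr)) ?_ ?_ ?_ ?_ ?_ ?_
  · filter_upwards [hW.mem_nhds hy] with z hz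
    exact (hslice' z hz).aestronglyMeasurable
  · exact (hslice' y hy).intervalIntegrable _ _
  · exact (hslice y hy hD).aestronglyMeasurable
  · refine Filter.Eventually.of_forall fun t ht z hz => hC _ ⟨Metric.ball_subset_closedBall hz, ?_⟩
    rw [uIoc_of_le zero_le_one] at ht
    exact Ioc_subset_Icc_self ht
  · exact intervalIntegrable_const
  · refine Filter.Eventually.of_forall fun t _ z hz => ?_
    have hz' : z ∈ W := hcb (Metric.ball_subset_closedBall hz)
    have h1 : HasFDerivAt G (fderiv ℝ G (z, t)) (z, t) :=
      ((hG.contDiffAt (hWo.mem_nhds ⟨hz', mem_univ t⟩)).differentiableAt (by simp)).hasFDerivAt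
    exact h1.comp z (hasFDerivAt_prodMk_left z t)

/-- Induction on the order of differentiability: the derivative is again such an integral, with
values in `E →L[ℝ] A`. The space `A` shares the universe of `E` so that the induction hypothesis
applies to this new target. -/
theorem contDiffOn_integral {A : Type u} [NormedAddCommGroup A] [NormedSpace ℝ A]
    {W : Set E} (hW : IsOpen W) {G : E × ℝ → A} (hG : ContDiffOn ℝ ∞ G (W ×ˢ univ)) :
    ContDiffOn ℝ ∞ (fun z => ∫ t in (0 : ℝ)..1, G (z, t)) W := by
  rw [contDiffOn_infty]
  intro n
  induction n generalizing A with
  | zero =>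
    refine contDiffOn_zero.2 fun y hy => ?_
    exact (hasFDerivAt_integral_of_contDiffOn hW hG hy).continuousAt.continuousWithinAt
  | succ n ih =>
    have hWo : IsOpen (W ×ˢ (univ : Set ℝ)) := hW.prod isOpen_univ
    have hG' : ContDiffOn ℝ ∞ (fun p => (fderiv ℝ G p).comp (ContinuousLinearMap.inl ℝ E ℝ))
        (W ×ˢ univ) := (hG.fderiv_of_isOpen hWo (by simp)).clm_comp contDiffOn_const
    push_cast
    rw [contDiffOn_succ_iff_fderiv_of_isOpen hW]
    refine ⟨fun y hy =>
      (hasFDerivAt_integral_of_contDiffOn hW hG hy).differentiableAt.differentiableWithinAt,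
      fun h => absurd h (by simp), ?_⟩
    exact (ih hG').congr fun y hy => (hasFDerivAt_integral_of_contDiffOn hW hG hy).fderiv

end Parametric

/-! ### The homotopy formula on an open set times ℝ. -/

section HomotopyFormula

variable {E : Type u} [NormedAddCommGroup E] [NormedSpace ℝ E]

/-- Contraction of a form on `E × ℝ` with the unit vector of `ℝ`, restricted to `E`. -/
def contractTime (E : Type u) [NormedAddCommGroup E] [NormedSpace ℝ E] (k : ℕ) :
    ((E × ℝ) [⋀^Fin (k + 1)]→L[ℝ] ℝ) →L[ℝ] E [⋀^Fin k]→L[ℝ] ℝ :=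
  (ContinuousAlternatingMap.compContinuousLinearMapCLM (ContinuousLinearMap.inl ℝ E ℝ)).comp
    ((ContinuousLinearMap.apply ℝ _ ((0, 1) : E × ℝ)).comp
      (ContinuousAlternatingMap.curryLeftLI (𝕜 := ℝ) (E := E × ℝ) (F := ℝ)
        (n := k)).toContinuousLinearMap)

theorem contractTime_apply {k : ℕ} (a : (E × ℝ) [⋀^Fin (k + 1)]→L[ℝ] ℝ) (v : Fin k → E) :
    contractTime E k a v = a (Fin.cons (0, 1) fun i => (v i, 0)) := rfl

/-- Cartan's formula at a point, with `D` the derivative of a closed form. Evaluate the vanishing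
exterior derivative on ∂/∂t followed by vectors of `E`: the first summand is the t-derivative, and
the others carry a shifted sign and form minus the exterior derivative of the contraction. -/
theorem alternatizeUncurryFin_contractTime {k : ℕ}
    {D : E × ℝ →L[ℝ] (E × ℝ) [⋀^Fin (k + 1)]→L[ℝ] ℝ}
    (hD : ContinuousAlternatingMap.alternatizeUncurryFin D = 0) :
    ContinuousAlternatingMap.alternatizeUncurryFin
      ((contractTime E k).comp (D.comp (ContinuousLinearMap.inl ℝ E ℝ))) =
      (D (0, 1)).compContinuousLinearMap (ContinuousLinearMap.inl ℝ E ℝ) := by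
  ext v
  have h := DFunLike.congr_fun hD
    (Fin.cons ((0, 1) : E × ℝ) fun i => ((v i, 0) : E × ℝ))
  rw [ContinuousAlternatingMap.alternatizeUncurryFin_apply, Fin.sum_univ_succ] at h
  rw [ContinuousAlternatingMap.alternatizeUncurryFin_apply]
  have key : ∀ i : Fin (k + 1), Fin.removeNth i.succ
      (Fin.cons ((0, 1) : E × ℝ) fun i => ((v i, 0) : E × ℝ) : Fin (k + 2) → E × ℝ) =
      Fin.cons ((0, 1) : E × ℝ) fun j => ((Fin.removeNth i v j, 0) : E × ℝ) := by
    intro i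
    funext j
    refine Fin.cases ?_ (fun j => ?_) j
    · simp [Fin.removeNth]
    · simp [Fin.removeNth]
  simp only [key, Fin.cons_succ, Fin.cons_zero, Fin.val_succ, pow_succ, Fin.val_zero, pow_zero,
    one_smul, Fin.removeNth_zero, Fin.tail_cons, mul_neg, mul_one, neg_smul,
    Finset.sum_neg_distrib] at h
  have h' := eq_of_sub_eq_zero ((sub_eq_add_neg _ _).trans h)
  exact h'.symm

theorem intervalIntegral_clm_comm {A B : Type*} [NormedAddCommGroup A] [NormedSpace ℝ A]
    [CompleteSpace A] [NormedAddCommGroup B] [NormedSpace ℝ B] [CompleteSpace B] (L : A →L[ℝ] B)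
    {g : ℝ → A} (hg : Continuous g) :
    ∫ t in (0 : ℝ)..1, L (g t) = L (∫ t in (0 : ℝ)..1, g t) :=
  L.intervalIntegral_comp_comm (hg.intervalIntegrable _ _)

/-- Moving the exterior derivative under the integral and using closedness turns the integrand into
the t-derivative of the restriction of η to `E`; the fundamental theorem of calculus finishes. -/
theorem extDeriv_integral_contractTime [FiniteDimensional ℝ E] {k : ℕ} {W : Set E} (hW : IsOpen W)
    {η : E × ℝ → (E × ℝ) [⋀^Fin (k + 1)]→L[ℝ] ℝ} (hη : ContDiffOn ℝ ∞ η (W ×ˢ univ))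
    (hd : ∀ p ∈ W ×ˢ (univ : Set ℝ), extDeriv η p = 0) {y : E} (hy : y ∈ W) :
    extDeriv (fun z => ∫ t in (0 : ℝ)..1, contractTime E k (η (z, t))) y =
      (η (y, 1)).compContinuousLinearMap (ContinuousLinearMap.inl ℝ E ℝ) -
      (η (y, 0)).compContinuousLinearMap (ContinuousLinearMap.inl ℝ E ℝ) := by
  have hWo : IsOpen (W ×ˢ (univ : Set ℝ)) := hW.prod isOpen_univ
  have hdiff : ∀ t : ℝ, HasFDerivAt η (fderiv ℝ η (y, t)) (y, t) := fun t =>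
    ((hη.contDiffAt (hWo.mem_nhds ⟨hy, mem_univ t⟩)).differentiableAt (by simp)).hasFDerivAt
  have hG : ContDiffOn ℝ ∞ (fun p => contractTime E k (η p)) (W ×ˢ univ) :=
    (contractTime E k).contDiff.comp_contDiffOn hη
  have hG' : ContinuousOn (fderiv ℝ η) (W ×ˢ univ) :=
    (hη.fderiv_of_isOpen (m := ∞) hWo (by simp)).continuousOn
  have hcont : Continuous fun t : ℝ => fderiv ℝ η (y, t) :=
    hG'.comp_continuous (by fun_prop) fun t => ⟨hy, mem_univ t⟩
  have hf : ∀ t : ℝ, fderiv ℝ (fun p => contractTime E k (η p)) (y, t) =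
      (contractTime E k).comp (fderiv ℝ η (y, t)) := fun t =>
    ((contractTime E k).hasFDerivAt.comp (y, t) (hdiff t)).fderiv
  rw [extDeriv, (hasFDerivAt_integral_of_contDiffOn hW hG hy).fderiv]
  simp only [hf]
  have hi : Continuous fun t : ℝ =>
      ((contractTime E k).comp (fderiv ℝ η (y, t))).comp (ContinuousLinearMap.inl ℝ E ℝ) :=
    (continuous_const.clm_comp hcont).clm_comp continuous_const
  have hint : ∀ t : ℝ, ContinuousAlternatingMap.alternatizeUncurryFinCLM ℝ E ℝ
      (((contractTime E k).comp (fderiv ℝ η (y, t))).comp (ContinuousLinearMap.inl ℝ E ℝ)) =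
      (fderiv ℝ η (y, t) (0, 1)).compContinuousLinearMap (ContinuousLinearMap.inl ℝ E ℝ) :=
    fun t => alternatizeUncurryFin_contractTime (hd (y, t) ⟨hy, mem_univ t⟩)
  have hcomm := intervalIntegral_clm_comm (A := E →L[ℝ] E [⋀^Fin k]→L[ℝ] ℝ)
    (B := E [⋀^Fin (k + 1)]→L[ℝ] ℝ) (ContinuousAlternatingMap.alternatizeUncurryFinCLM ℝ E ℝ) hi
  refine hcomm.symm.trans ?_
  simp only [hint]
  refine intervalIntegral.integral_eq_sub_of_hasDerivAt
    (f := fun t => (η (y, t)).compContinuousLinearMap (ContinuousLinearMap.inl ℝ E ℝ)) ?_ ?_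
  · intro t _
    have h1 : HasDerivAt (fun t : ℝ => η (y, t)) (fderiv ℝ η (y, t) (0, 1)) t :=
      (hdiff t).comp_hasDerivAt t ((hasDerivAt_const t y).prodMk (hasDerivAt_id t))
    exact (ContinuousAlternatingMap.compContinuousLinearMapCLM
      (ContinuousLinearMap.inl ℝ E ℝ)).hasFDerivAt.comp_hasDerivAt t h1
  · refine Continuous.intervalIntegrable ?_ _ _
    exact (ContinuousAlternatingMap.compContinuousLinearMapCLM
      (ContinuousLinearMap.inl ℝ E ℝ)).continuous.comp (hcont.clm_apply continuous_const)

/-- A closed `0`-form on `W × ℝ` does not depend on the real parameter. -/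
theorem eq_of_extDeriv_eq_zero {W : Set E} (hW : IsOpen W)
    {η : E × ℝ → (E × ℝ) [⋀^Fin 0]→L[ℝ] ℝ} (hη : ContDiffOn ℝ ∞ η (W ×ˢ univ))
    (hd : ∀ p ∈ W ×ˢ (univ : Set ℝ), extDeriv η p = 0) {y : E} (hy : y ∈ W) (s t : ℝ) :
    η (y, s) = η (y, t) := by
  have hWo : IsOpen (W ×ˢ (univ : Set ℝ)) := hW.prod isOpen_univ
  have hdiff : ∀ t : ℝ, HasFDerivAt η (fderiv ℝ η (y, t)) (y, t) := fun t =>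
    ((hη.contDiffAt (hWo.mem_nhds ⟨hy, mem_univ t⟩)).differentiableAt (by simp)).hasFDerivAt
  have h1 : ∀ t : ℝ, HasDerivAt (fun t : ℝ => η (y, t)) (fderiv ℝ η (y, t) (0, 1)) t := fun t =>
    (hdiff t).comp_hasDerivAt t ((hasDerivAt_const t y).prodMk (hasDerivAt_id t))
  refine is_const_of_deriv_eq_zero (f := fun t : ℝ => η (y, t))
    (fun t => (h1 t).differentiableAt) (fun t => ?_) s t
  rw [(h1 t).deriv]
  ext v
  -- On a 0-form, the exterior derivative evaluated at ∂/∂t is the t-derivative.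
  have h := DFunLike.congr_fun (hd (y, t) ⟨hy, mem_univ t⟩) fun _ => ((0, 1) : E × ℝ)
  rw [extDeriv, ContinuousAlternatingMap.alternatizeUncurryFin_apply] at h
  simp only [Fin.sum_univ_succ, Finset.univ_eq_empty, Finset.sum_empty, add_zero, Fin.val_zero,
    pow_zero, one_smul] at h
  rw [Subsingleton.elim v (Fin.removeNth 0 fun _ : Fin 1 => ((0, 1) : E × ℝ))]
  exact h

end HomotopyFormula

end Calculus

end

noncomputable section

/-! ### Pullback of forms between manifolds, in charts. -/

section ManifoldPullback

variable {E F G : Type*} [NormedAddCommGroup E] [NormedSpace ℝ E]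
  [NormedAddCommGroup F] [NormedSpace ℝ F] [NormedAddCommGroup G] [NormedSpace ℝ G]
  {M N P : Type*} [TopologicalSpace M] [ChartedSpace E M]
  [TopologicalSpace N] [ChartedSpace F N] [TopologicalSpace P] [ChartedSpace G P]

theorem PullsBackOn.mono {k : ℕ} {f : M → N} {U V : Set M} {α : FormFamily F N k}
    {η : FormFamily E M k} (h : PullsBackOn f V α η) (hUV : U ⊆ V) : PullsBackOn f U α η :=
  fun e e' y hy hU hs => h e e' y hy (hUV hU) hs

theorem PullsBackOn.congr {k : ℕ} {f f' : M → N} {U : Set M} (hU : IsOpen U)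
    {α : FormFamily F N k} {η : FormFamily E M k} (h : PullsBackOn f U α η)
    (hff' : EqOn f' f U) : PullsBackOn f' U α η := by
  intro e e' y hy hyU hs
  have hev : (fun z => e'.1 (f' (e.1.symm z))) =ᶠ[𝓝 y] fun z => e'.1 (f (e.1.symm z)) := by
    filter_upwards [(e.1.continuousAt_symm hy).preimage_mem_nhds (hU.mem_nhds hyU)] with z hz
    rw [hff' hz]
  rw [hev.fderiv_eq, hff' hyU]
  rw [hff' hyU] at hs
  exact h e e' y hy hyU hs

theorem PullsBackOn.eq {k : ℕ} {f : M → N} {U : Set M} {α : FormFamily F N k}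
    {η η' : FormFamily E M k} (h : PullsBackOn f U α η) (h' : PullsBackOn f U α η')
    {e : atlas E M} {y : E} (hy : y ∈ e.1.target) (hyU : e.1.symm y ∈ U) : η e y = η' e y := by
  let e' : atlas F N := ⟨chartAt F (f (e.1.symm y)), chart_mem_atlas _ _⟩
  have hs : f (e.1.symm y) ∈ e'.1.source := mem_chart_source _ _
  rw [h e e' y hy hyU hs, h' e e' y hy hyU hs]

/-- Two families of forms, continuous on `U`, agree on `U` if every nonempty open subset of `U`
contains a nonempty open subset on which they agree. -/
theorem FormFamily.eq_of_dense {k : ℕ} {U : Set M} (hU : IsOpen U) {η η' : FormFamily E M k}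
    {e : atlas E M} (hη : ContinuousOn (η e) (e.1.target ∩ e.1.symm ⁻¹' U))
    (hη' : ContinuousOn (η' e) (e.1.target ∩ e.1.symm ⁻¹' U))
    (H : ∀ W ⊆ U, IsOpen W → W.Nonempty → ∃ z ∈ W, ∀ y ∈ e.1.target, e.1.symm y = z →
      η e y = η' e y)
    {y : E} (hy : y ∈ e.1.target) (hyU : e.1.symm y ∈ U) : η e y = η' e y := by
  by_contra hne
  have hso : IsOpen (e.1.target ∩ e.1.symm ⁻¹' U) := e.1.isOpen_inter_preimage_symm hU
  -- The locus of disagreement is open; transported to `M`, it is a nonempty open set with no point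
  -- of agreement.
  have hO : IsOpen {z ∈ e.1.target ∩ e.1.symm ⁻¹' U | η e z - η' e z ∈ ({0}ᶜ : Set _)} :=
    (hη.sub hη').isOpen_inter_preimage hso isOpen_compl_singleton
  have hWo : IsOpen (e.1.source ∩ e.1 ⁻¹'
      {z ∈ e.1.target ∩ e.1.symm ⁻¹' U | η e z - η' e z ∈ ({0}ᶜ : Set _)}) :=
    e.1.isOpen_inter_preimage hO
  obtain ⟨z, hz, h⟩ := H _ (fun z hz => by
      have h := hz.2.1.2
      rwa [mem_preimage, e.1.left_inv hz.1] at h) hWo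
    ⟨e.1.symm y, e.1.map_target hy, by
      rw [mem_preimage, e.1.right_inv hy]
      exact ⟨⟨hy, hyU⟩, sub_ne_zero.2 hne⟩⟩
  exact hz.2.2 (sub_eq_zero.2 (h (e.1 z) hz.2.1.1 (e.1.left_inv hz.1)))

variable [IsManifold 𝓘(ℝ, E) ∞ M] [IsManifold 𝓘(ℝ, F) ∞ N] [IsManifold 𝓘(ℝ, G) ∞ P]

theorem contDiffAt_chart_comp_symm {f : M → N} {U : Set M} (hU : IsOpen U)
    (hf : ContMDiffOn 𝓘(ℝ, E) 𝓘(ℝ, F) ∞ f U) {e : atlas E M} {e' : atlas F N} {y : E}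
    (hy : y ∈ e.1.target) (hyU : e.1.symm y ∈ U) (hs : f (e.1.symm y) ∈ e'.1.source) :
    ContDiffAt ℝ ∞ (fun z => e'.1 (f (e.1.symm z))) y := by
  rw [← contMDiffAt_iff_contDiffAt]
  have h1 : ContMDiffAt 𝓘(ℝ, E) 𝓘(ℝ, E) ∞ e.1.symm y :=
    (contMDiffOn_symm_of_mem_maximalAtlas
      (IsManifold.subset_maximalAtlas e.2)).contMDiffAt (e.1.open_target.mem_nhds hy)
  have h2 : ContMDiffAt 𝓘(ℝ, E) 𝓘(ℝ, F) ∞ f (e.1.symm y) :=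
    hf.contMDiffAt (hU.mem_nhds hyU)
  have h3 : ContMDiffAt 𝓘(ℝ, F) 𝓘(ℝ, F) ∞ e'.1 (f (e.1.symm y)) :=
    (contMDiffOn_of_mem_maximalAtlas
      (IsManifold.subset_maximalAtlas e'.2)).contMDiffAt (e'.1.open_source.mem_nhds hs)
  exact h3.comp y (h2.comp y h1)

/-- The chain rule in charts. -/
theorem fderiv_chart_comp {f : M → N} {U : Set M} (hU : IsOpen U)
    (hf : ContMDiffOn 𝓘(ℝ, E) 𝓘(ℝ, F) ∞ f U) {g : N → P} {V : Set N} (hV : IsOpen V)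
    (hg : ContMDiffOn 𝓘(ℝ, F) 𝓘(ℝ, G) ∞ g V) {e : atlas E M} {e' : atlas F N} {e'' : atlas G P}
    {y : E} (hy : y ∈ e.1.target) (hyU : e.1.symm y ∈ U) (hyV : f (e.1.symm y) ∈ V)
    (hs : f (e.1.symm y) ∈ e'.1.source) (hs' : g (f (e.1.symm y)) ∈ e''.1.source) :
    fderiv ℝ (fun z => e''.1 (g (f (e.1.symm z)))) y =
      (fderiv ℝ (fun z => e''.1 (g (e'.1.symm z))) (e'.1 (f (e.1.symm y)))).comp
        (fderiv ℝ (fun z => e'.1 (f (e.1.symm z))) y) := by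
  have hleft : e'.1.symm (e'.1 (f (e.1.symm y))) = f (e.1.symm y) := e'.1.left_inv hs
  have h1 := (contDiffAt_chart_comp_symm hU hf hy hyU hs).differentiableAt (by simp)
  have h2 := (contDiffAt_chart_comp_symm (e := e') (e' := e'') hV hg (e'.1.map_source hs)
    (by rwa [hleft]) (by rwa [hleft])).differentiableAt (by simp)
  have h3 := h2.hasFDerivAt.comp y h1.hasFDerivAt
  refine HasFDerivAt.fderiv (h3.congr_of_eventuallyEq ?_)
  have hfc : ContinuousAt (fun z => f (e.1.symm z)) y :=
    ContinuousAt.comp (f := e.1.symm) (g := f)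
      (hf.continuousOn.continuousAt (hU.mem_nhds hyU)) (e.1.continuousAt_symm hy)
  filter_upwards [hfc.preimage_mem_nhds (e'.1.open_source.mem_nhds hs)] with z hz
  change _ = e''.1 (g (e'.1.symm (e'.1 (f (e.1.symm z)))))
  rw [e'.1.left_inv hz]

theorem PullsBackOn.comp {k : ℕ} {f : M → N} {U : Set M} (hU : IsOpen U)
    (hf : ContMDiffOn 𝓘(ℝ, E) 𝓘(ℝ, F) ∞ f U) {g : N → P} {V : Set N} (hV : IsOpen V)
    (hg : ContMDiffOn 𝓘(ℝ, F) 𝓘(ℝ, G) ∞ g V) {β : FormFamily G P k} {α : FormFamily F N k}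
    {η : FormFamily E M k} (h : PullsBackOn f U α η) (h' : PullsBackOn g V β α) :
    PullsBackOn (g ∘ f) (U ∩ f ⁻¹' V) β η := by
  rintro e e'' y hy ⟨hyU, hyV⟩ hs'
  let e' : atlas F N := ⟨chartAt F (f (e.1.symm y)), chart_mem_atlas _ _⟩
  have hs : f (e.1.symm y) ∈ e'.1.source := mem_chart_source _ _
  have hleft : e'.1.symm (e'.1 (f (e.1.symm y))) = f (e.1.symm y) := e'.1.left_inv hs
  have h2 := h' e' e'' (e'.1 (f (e.1.symm y))) (e'.1.map_source hs) (by rwa [hleft])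
    (by rwa [hleft])
  rw [h e e' y hy hyU hs, h2, hleft]
  simp only [Function.comp_apply]
  rw [fderiv_chart_comp hU hf hV hg hy hyU hyV hs hs']
  rfl

/-- Cancellation: pullbacks along `g` and `g ∘ f` are related by pullback along `f`. -/
theorem PullsBackOn.of_comp {k : ℕ} {f : M → N} {U : Set M} (hU : IsOpen U)
    (hf : ContMDiffOn 𝓘(ℝ, E) 𝓘(ℝ, F) ∞ f U) {g : N → P} {V : Set N} (hV : IsOpen V)
    (hg : ContMDiffOn 𝓘(ℝ, F) 𝓘(ℝ, G) ∞ g V) {β : FormFamily G P k} {α : FormFamily F N k}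
    {η : FormFamily E M k} (h : PullsBackOn (g ∘ f) U β η) (h' : PullsBackOn g V β α) :
    PullsBackOn f (U ∩ f ⁻¹' V) α η := by
  rintro e e' y hy ⟨hyU, hyV⟩ hs
  let e'' : atlas G P := ⟨chartAt G (g (f (e.1.symm y))), chart_mem_atlas _ _⟩
  have hs' : g (f (e.1.symm y)) ∈ e''.1.source := mem_chart_source _ _
  have hleft : e'.1.symm (e'.1 (f (e.1.symm y))) = f (e.1.symm y) := e'.1.left_inv hs
  have h2 := h' e' e'' (e'.1 (f (e.1.symm y))) (e'.1.map_source hs) (by rwa [hleft])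
    (by rwa [hleft])
  rw [h e e'' y hy hyU hs', h2, hleft]
  simp only [Function.comp_apply]
  rw [fderiv_chart_comp hU hf hV hg hy hyU hyV hs hs']
  rfl

open Classical in
/-- The pullback of a family of forms along a map, computed with the preferred charts of the
target. -/
def FormFamily.pullback {k : ℕ} (f : M → N) (α : FormFamily F N k) : FormFamily E M k :=
  fun e y => if y ∈ e.1.target then
    (α ⟨chartAt F (f (e.1.symm y)), chart_mem_atlas _ _⟩
      (chartAt F (f (e.1.symm y)) (f (e.1.symm y)))).compContinuousLinearMap
      (fderiv ℝ (fun z => chartAt F (f (e.1.symm y)) (f (e.1.symm z))) y) else 0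

/-- Compatibility of α with the transition maps of `N`, together with the chain rule, replaces the
preferred chart by an arbitrary one. -/
theorem pullsBackOn_pullback {k : ℕ} {f : M → N} {U : Set M} (hU : IsOpen U)
    (hf : ContMDiffOn 𝓘(ℝ, E) 𝓘(ℝ, F) ∞ f U) {α : FormFamily F N k}
    (hα : α ∈ ManifoldForm F N k) : PullsBackOn f U α (α.pullback f : FormFamily E M k) := by
  intro e e'' y hy hyU hs'
  let e' : atlas F N := ⟨chartAt F (f (e.1.symm y)), chart_mem_atlas _ _⟩
  have hs : f (e.1.symm y) ∈ e'.1.source := mem_chart_source _ _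
  have hleft : e'.1.symm (e'.1 (f (e.1.symm y))) = f (e.1.symm y) := e'.1.left_inv hs
  have h2 := hα.2.2 e' e'' (e'.1 (f (e.1.symm y))) (e'.1.map_source hs) (mem_univ _)
    (by rw [hleft]; exact hs')
  have h1 : (α.pullback f : FormFamily E M k) e y = (α e' (e'.1 (f (e.1.symm y)))).compContinuousLinearMap
      (fderiv ℝ (fun z => e'.1 (f (e.1.symm z))) y) := if_pos hy
  have h3 := fderiv_chart_comp hU hf isOpen_univ
    (contMDiffOn_id (I := 𝓘(ℝ, F)) (n := ∞) (M := N)) (e' := e') (e'' := e'') hy hyU (mem_univ _)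
    hs hs'
  simp only [id] at h2 h3
  rw [h1, h2, hleft, h3]
  rfl

theorem PullsBackOn.contDiffOn {k : ℕ} {f : M → N} {U : Set M} (hU : IsOpen U)
    (hf : ContMDiffOn 𝓘(ℝ, E) 𝓘(ℝ, F) ∞ f U) {α : FormFamily F N k} {η : FormFamily E M k}
    (hα : ∀ e, ContDiffOn ℝ ∞ (α e) e.1.target) (h : PullsBackOn f U α η) (e : atlas E M) :
    ContDiffOn ℝ ∞ (η e) (e.1.target ∩ e.1.symm ⁻¹' U) := by
  rintro y ⟨hy, hyU⟩
  refine ContDiffAt.contDiffWithinAt ?_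
  let e' : atlas F N := ⟨chartAt F (f (e.1.symm y)), chart_mem_atlas _ _⟩
  have hs : f (e.1.symm y) ∈ e'.1.source := mem_chart_source _ _
  let s : Set E := e.1.target ∩ e.1.symm ⁻¹' (U ∩ f ⁻¹' e'.1.source)
  have hso : IsOpen s := e.1.isOpen_inter_preimage_symm
    (hf.continuousOn.isOpen_inter_preimage hU e'.1.open_source)
  have hg : ContDiffOn ℝ ∞ (fun z => e'.1 (f (e.1.symm z))) s := fun z hz =>
    (contDiffAt_chart_comp_symm hU hf hz.1 hz.2.1 hz.2.2).contDiffWithinAt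
  have h1 : ContDiffOn ℝ ∞ (fun z => α e' (e'.1 (f (e.1.symm z)))) s :=
    (hα e').comp hg fun z hz => e'.1.map_source hz.2.2
  have h2 := h1.compContinuousLinearMap (hg.fderiv_of_isOpen (m := ∞) hso (by simp))
  exact (h2.congr fun z hz => h e e' z hz.1 hz.2.1 hz.2.2).contDiffAt
    (hso.mem_nhds ⟨hy, hyU, hs⟩)

end ManifoldPullback

/-- Two continuous maps that agree up to the action of a countable group agree, on some nonempty
open set, up to a single element of the group. -/
theorem exists_isOpen_eq_smul {M N Γ : Type*} [TopologicalSpace M] [T2Space M]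
    [LocallyCompactSpace M] [TopologicalSpace N] [T2Space N] [Group Γ] [Countable Γ]
    [MulAction Γ N] [ContinuousConstSMul Γ N] {U : Set M} (hU : IsOpen U) (hne : U.Nonempty)
    {h h' : M → N} (hh : ContinuousOn h U) (hh' : ContinuousOn h' U)
    (H : ∀ z ∈ U, ∃ γ : Γ, γ • h z = h' z) :
    ∃ (W : Set M) (γ : Γ), W ⊆ U ∧ IsOpen W ∧ W.Nonempty ∧ ∀ z ∈ W, h' z = γ • h z := by
  have : LocallyCompactSpace U := hU.locallyCompactSpace
  have : Nonempty U := hne.to_subtype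
  have hcl : ∀ γ : Γ, IsClosed {z : U | γ • h z = h' z} := fun γ =>
    isClosed_eq (hh.domRestrict.const_smul γ) hh'.domRestrict
  -- Baire: countably many closed coincidence sets cover the locally compact Hausdorff space `U`, so
  -- one of them has interior.
  obtain ⟨γ, z, hz⟩ := nonempty_interior_of_iUnion_of_closed hcl
    (eq_univ_of_forall fun z => mem_iUnion.2 (H z z.2))
  refine ⟨Subtype.val '' interior {z : U | γ • h z = h' z}, γ, Subtype.coe_image_subset _ _,
    hU.isOpenMap_subtype_val _ isOpen_interior, ⟨z, z, hz, rfl⟩, ?_⟩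
  rintro _ ⟨w, hw, rfl⟩
  have h1 : w ∈ {z : U | γ • h z = h' z} := interior_subset hw
  exact h1.symm

end

noncomputable section

namespace Quasifold

/-! ### Pullback along smooth maps of quasifolds, and its functoriality. -/

section Pullback

variable {E F G : Type*} [NormedAddCommGroup E] [NormedSpace ℝ E]
  [NormedAddCommGroup F] [NormedSpace ℝ F] [NormedAddCommGroup G] [NormedSpace ℝ G]
  {X Y Z : Type*} [TopologicalSpace X] [TopologicalSpace Y] [TopologicalSpace Z]
  {Q : Quasifold E X} {R : Quasifold F Y} {S : Quasifold G Z}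

theorem exists_smul_eq_of_proj_eq {i : Q.Idx} {a b : Q.Cov i} (h : Q.proj i a = Q.proj i b) :
    ∃ γ : Q.Gp i, γ • b = a :=
  Quotient.exact ((Q.isOpenEmbedding_φ i).injective h)

theorem proj_smul (i : Q.Idx) (γ : Q.Gp i) (a : Q.Cov i) : Q.proj i (γ • a) = Q.proj i a :=
  congrArg (Q.φ i) (Quotient.sound ⟨γ, rfl⟩)

theorem IsLocalLift.mono {f : X → Y} {i : Q.Idx} {j : R.Idx} {U V : Set (Q.Cov i)}
    {h : Q.Cov i → R.Cov j} (hl : IsLocalLift Q R f i j U h) (hV : IsOpen V) (hVU : V ⊆ U) :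
    IsLocalLift Q R f i j V h :=
  ⟨hV, hl.smooth.mono hVU, fun z hz => hl.lift z (hVU hz)⟩

theorem IsLocalLift.comp {f : X → Y} {g : Y → Z} {i : Q.Idx} {j : R.Idx} {l : S.Idx}
    {U : Set (Q.Cov i)} {V : Set (R.Cov j)} {h : Q.Cov i → R.Cov j} {h' : R.Cov j → S.Cov l}
    (hl' : IsLocalLift R S g j l V h') (hl : IsLocalLift Q R f i j U h) :
    IsLocalLift Q S (g ∘ f) i l (U ∩ h ⁻¹' V) (h' ∘ h) where
  isOpen := hl.smooth.continuousOn.isOpen_inter_preimage hl.isOpen hl'.isOpen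
  smooth := hl'.smooth.comp (hl.smooth.mono inter_subset_left) fun _ hz => hz.2
  lift z hz := by
    rw [Function.comp_apply, hl'.lift _ hz.2, hl.lift _ hz.1, Function.comp_apply]

theorem IsSmooth.comp {f : X → Y} {g : Y → Z} (hg : IsSmooth R S g) (hf : IsSmooth Q R f) :
    IsSmooth Q S (g ∘ f) := by
  intro i x
  obtain ⟨j, U, h, hx, hl⟩ := hf i x
  obtain ⟨l, V, h', hx', hl'⟩ := hg j (h x)
  exact ⟨l, U ∩ h ⁻¹' V, h' ∘ h, ⟨hx, hx'⟩, hl'.comp hl⟩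

theorem isSmooth_id (Q : Quasifold E X) : IsSmooth Q Q id := fun i x =>
  ⟨i, univ, id, mem_univ x, isOpen_univ, contMDiffOn_id, fun _ _ => rfl⟩

/-- A tuple of families of forms that is the pullback of a form along all local lifts is compatible
with all local smooth lifts of the identity. -/
theorem pullsBackOn_of_isLocalLift_id {f : X → Y} (hf : IsSmooth Q R f) {k : ℕ} (α : R.Form k)
    {η : Q.FormTuple k}
    (H : ∀ (i : Q.Idx) (j : R.Idx) (U : Set (Q.Cov i)) (h : Q.Cov i → R.Cov j),
      IsLocalLift Q R f i j U h → PullsBackOn h U (α.1 j) (η i))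
    {i i' : Q.Idx} {W : Set (Q.Cov i)} {m : Q.Cov i → Q.Cov i'}
    (hm : IsLocalLift Q Q id i i' W m) : PullsBackOn m W (η i') (η i) := by
  intro e e' y hy hyW hs
  obtain ⟨j, U, h, hx, hl⟩ := hf i' (m (e.1.symm y))
  -- Both `h` and `h ∘ m` lift `f`, so cancelling `h` leaves the pullback along `m`.
  have hc : IsLocalLift Q R f i j (W ∩ m ⁻¹' U) (h ∘ m) := hl.comp hm
  exact PullsBackOn.of_comp hc.isOpen (hm.smooth.mono inter_subset_left) hl.isOpen hl.smooth
    (H _ _ _ _ hc) (H _ _ _ _ hl) e e' y hy ⟨⟨hyW, hx⟩, hx⟩ hs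

theorem IsPullback.unique {f : X → Y} (hf : IsSmooth Q R f) {k : ℕ} {α : R.Form k}
    {η η' : Q.Form k} (h : IsPullback Q R f α η) (h' : IsPullback Q R f α η') : η = η' := by
  ext1
  funext i e y
  by_cases hy : y ∈ e.1.target
  · obtain ⟨j, U, g, hx, hl⟩ := hf i (e.1.symm y)
    exact (h _ _ _ _ hl).eq (h' _ _ _ _ hl) hy hx
  · rw [(η.2.1 i).2.1 e y hy, (η'.2.1 i).2.1 e y hy]

theorem IsPullback.d {f : X → Y} {k : ℕ} {α : R.Form k} {η : Q.Form k}
    (h : IsPullback Q R f α η) : IsPullback Q R f (R.d k α) (Q.d k η) :=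
  fun i j U g hl => PullsBackOn.d hl.isOpen hl.smooth (α.2.1 j).1 (h i j U g hl)

variable [FiniteDimensional ℝ E]

/-- Local lifts of a map to the same chart define the same pullback of a form. -/
theorem eq_of_isLocalLift_same {f : X → Y} {k : ℕ} (α : R.Form k) {i : Q.Idx} {j : R.Idx}
    {U : Set (Q.Cov i)} {h h' : Q.Cov i → R.Cov j} (hl : IsLocalLift Q R f i j U h)
    (hl' : IsLocalLift Q R f i j U h') {η η' : FormFamily E (Q.Cov i) k}
    (hη : PullsBackOn h U (α.1 j) η) (hη' : PullsBackOn h' U (α.1 j) η')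
    {e : atlas E (Q.Cov i)} {y : E} (hy : y ∈ e.1.target) (hyU : e.1.symm y ∈ U) :
    η e y = η' e y := by
  have : LocallyCompactSpace (Q.Cov i) := ChartedSpace.locallyCompactSpace E _
  have := R.continuousConstSMul j
  refine FormFamily.eq_of_dense hl.isOpen
    (hη.contDiffOn hl.isOpen hl.smooth (α.2.1 j).1 e).continuousOn
    (hη'.contDiffOn hl.isOpen hl'.smooth (α.2.1 j).1 e).continuousOn ?_ hy hyU
  intro W hWU hW hne
  obtain ⟨V, γ, hVW, hV, ⟨z, hz⟩, hγ⟩ := exists_isOpen_eq_smul (Γ := R.Gp j) hW hne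
    (hl.smooth.continuousOn.mono hWU) (hl'.smooth.continuousOn.mono hWU) (fun z hz =>
      exists_smul_eq_of_proj_eq ((hl'.lift z (hWU hz)).trans (hl.lift z (hWU hz)).symm))
  have hVU : V ⊆ U := hVW.trans hWU
  refine ⟨z, hVW hz, fun w hw hwz => ?_⟩
  -- By invariance of α under γ, the pullback along `h` is also the pullback along `γ • h`, which is
  -- `h'` on `V`.
  have h1 := PullsBackOn.comp hV (hl.smooth.mono hVU) isOpen_univ
    (R.smooth_smul j γ).contMDiffOn (hη.mono hVU) (α.2.2.1 j γ)
  rw [preimage_univ, inter_univ] at h1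
  exact (h1.congr hV hγ).eq (hη'.mono hVU) hw (hwz ▸ hz)

/-- All local lifts of a map define the same pullback of a form. -/
theorem eq_of_isLocalLift {f : X → Y} {k : ℕ} (α : R.Form k) {i : Q.Idx} {j j' : R.Idx}
    {U U' : Set (Q.Cov i)} {h : Q.Cov i → R.Cov j} {h' : Q.Cov i → R.Cov j'}
    (hl : IsLocalLift Q R f i j U h) (hl' : IsLocalLift Q R f i j' U' h')
    {η η' : FormFamily E (Q.Cov i) k}
    (hη : PullsBackOn h U (α.1 j) η) (hη' : PullsBackOn h' U' (α.1 j') η')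
    {e : atlas E (Q.Cov i)} {y : E} (hy : y ∈ e.1.target) (hyU : e.1.symm y ∈ U)
    (hyU' : e.1.symm y ∈ U') : η e y = η' e y := by
  have hr : R.proj j (h (e.1.symm y)) ∈ range (R.φ j') := by
    rw [hl.lift _ hyU, ← hl'.lift _ hyU']
    exact mem_range_self _
  -- Composing `h` with a change of charts gives a lift into the chart `j'` with the same pullback,
  -- which reduces to lifts into one chart.
  obtain ⟨c, hc, hc1, hc2, hc3⟩ := R.change j j' _ hr
  have hlc : IsLocalLift R R id j j' c.source c := ⟨c.open_source, hc1, hc3⟩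
  have hcomp : IsLocalLift Q R f i j' (U ∩ h ⁻¹' c.source) (c ∘ h) := hlc.comp hl
  have h1 : PullsBackOn (c ∘ h) (U ∩ h ⁻¹' c.source) (α.1 j') η :=
    hη.comp hl.isOpen hl.smooth c.open_source hc1 (α.2.2.2 j j' c hc1 hc2 hc3)
  have ho : IsOpen ((U ∩ h ⁻¹' c.source) ∩ U') := hcomp.isOpen.inter hl'.isOpen
  exact eq_of_isLocalLift_same α (hcomp.mono ho inter_subset_left)
    (hl'.mono ho inter_subset_right) (h1.mono inter_subset_left) (hη'.mono inter_subset_right) hy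
    ⟨⟨hyU, hc⟩, hyU'⟩

/-- Independence of the lift lets η be tested at each point against a different lift and a different
comparison form ζ. This freedom is needed for `pullbackTuple`, where the lift is chosen point by
point. -/
theorem pullsBackOn_of_local {f : X → Y} {k : ℕ} (α : R.Form k) {i : Q.Idx}
    {η : FormFamily E (Q.Cov i) k}
    (H : ∀ (e : atlas E (Q.Cov i)), ∀ y ∈ e.1.target,
      ∃ (j : R.Idx) (U : Set (Q.Cov i)) (h : Q.Cov i → R.Cov j)
        (ζ : FormFamily E (Q.Cov i) k), e.1.symm y ∈ U ∧
        IsLocalLift Q R f i j U h ∧ PullsBackOn h U (α.1 j) ζ ∧ η e y = ζ e y)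
    {j : R.Idx} {U : Set (Q.Cov i)} {h : Q.Cov i → R.Cov j}
    (hl : IsLocalLift Q R f i j U h) : PullsBackOn h U (α.1 j) η := by
  intro e e' y hy hyU hs
  obtain ⟨j', U', h', ζ, hyU', hl', hζ, hηζ⟩ := H e y hy
  have h1 := pullsBackOn_pullback hl.isOpen hl.smooth (α.2.1 j)
  rw [hηζ, eq_of_isLocalLift α hl' hl hζ h1 hy hyU' hyU]
  exact h1 e e' y hy hyU hs

theorem IsPullback.of_local {f : X → Y} {k : ℕ} {α : R.Form k} {η : Q.Form k}
    (H : ∀ (i : Q.Idx) (x : Q.Cov i), ∃ (j : R.Idx) (U : Set (Q.Cov i)) (h : Q.Cov i → R.Cov j),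
      x ∈ U ∧ IsLocalLift Q R f i j U h ∧ PullsBackOn h U (α.1 j) (η.1 i)) :
    IsPullback Q R f α η := by
  intro i j U h hl
  refine pullsBackOn_of_local α (fun e y _ => ?_) hl
  obtain ⟨j', U', h', hx, hl', hp⟩ := H i (e.1.symm y)
  exact ⟨j', U', h', η.1 i, hx, hl', hp, rfl⟩

open Classical in
/-- The tuple of families of forms underlying the pullback of a form along a smooth map. -/
def pullbackTuple {f : X → Y} (hf : IsSmooth Q R f) {k : ℕ} (α : R.Form k) : Q.FormTuple k :=
  fun i e y => if y ∈ e.1.target then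
    (α.1 (hf i (e.1.symm y)).choose).pullback (hf i (e.1.symm y)).choose_spec.choose_spec.choose e y
    else 0

theorem pullsBackOn_pullbackTuple {f : X → Y} (hf : IsSmooth Q R f) {k : ℕ} (α : R.Form k)
    {i : Q.Idx} {j : R.Idx} {U : Set (Q.Cov i)} {h : Q.Cov i → R.Cov j}
    (hl : IsLocalLift Q R f i j U h) : PullsBackOn h U (α.1 j) (pullbackTuple hf α i) := by
  refine pullsBackOn_of_local α (fun e y hy => ?_) hl
  have hs := (hf i (e.1.symm y)).choose_spec.choose_spec.choose_spec
  exact ⟨_, _, _, _, hs.1, hs.2, pullsBackOn_pullback hs.2.isOpen hs.2.smooth (α.2.1 _), if_pos hy⟩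

theorem pullbackTuple_mem {f : X → Y} (hf : IsSmooth Q R f) {k : ℕ} (α : R.Form k) :
    pullbackTuple hf α ∈ Q.Form k := by
  -- Compatibility of manifold charts, group invariance and compatibility with changes of charts are
  -- one condition: the identity, each γ and each change of charts are local lifts of the identity
  -- of `X`.
  have H : ∀ (i i' : Q.Idx) (W : Set (Q.Cov i)) (m : Q.Cov i → Q.Cov i'),
      IsLocalLift Q Q id i i' W m → PullsBackOn m W (pullbackTuple hf α i')
        (pullbackTuple hf α i) := fun i i' W m hm =>
    pullsBackOn_of_isLocalLift_id hf α
      (fun i j U h hl => pullsBackOn_pullbackTuple hf α hl) hm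
  refine ⟨fun i => ⟨fun e y hy => ?_, fun e y hy => if_neg hy, ?_⟩, fun i γ => ?_,
    fun i j h h1 h2 h3 => ?_⟩
  · obtain ⟨j, U, h, hx, hl⟩ := hf i (e.1.symm y)
    exact (((pullsBackOn_pullbackTuple hf α hl).contDiffOn hl.isOpen hl.smooth (α.2.1 j).1
      e).contDiffAt ((e.1.isOpen_inter_preimage_symm hl.isOpen).mem_nhds
        ⟨hy, hx⟩)).contDiffWithinAt
  · exact H i i univ id ⟨isOpen_univ, contMDiffOn_id, fun _ _ => rfl⟩
  · exact H i i univ _ ⟨isOpen_univ, (Q.smooth_smul i γ).contMDiffOn, fun z _ => proj_smul i γ z⟩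
  · exact H i j h.source h ⟨h.open_source, h1, h3⟩

theorem IsPullback.comp [FiniteDimensional ℝ F] {f : X → Y} {g : Y → Z} (hf : IsSmooth Q R f)
    (hg : IsSmooth R S g) {k : ℕ} {β : S.Form k} {α : R.Form k} {η : Q.Form k}
    (h : IsPullback Q R f α η) (h' : IsPullback R S g β α) : IsPullback Q S (g ∘ f) β η := by
  refine .of_local fun i x => ?_
  obtain ⟨j, U, m, hx, hl⟩ := hf i x
  obtain ⟨l, V, m', hx', hl'⟩ := hg j (m x)
  exact ⟨l, U ∩ m ⁻¹' V, m' ∘ m, ⟨hx, hx'⟩, hl'.comp hl, PullsBackOn.comp hl.isOpen hl.smooth hl'.isOpen hl'.smooth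
    (h _ _ _ _ hl) (h' _ _ _ _ hl')⟩

theorem isPullback_id {k : ℕ} (α : Q.Form k) : IsPullback Q Q id α α :=
  .of_local fun i x => ⟨i, univ, id, mem_univ x, ⟨isOpen_univ, contMDiffOn_id, fun _ _ => rfl⟩,
    (α.2.1 i).2.2⟩

/-- The pullback of forms along a smooth map. -/
def pullback {f : X → Y} (hf : IsSmooth Q R f) (k : ℕ) : R.Form k →ₗ[ℝ] Q.Form k where
  toFun α := ⟨pullbackTuple hf α, pullbackTuple_mem hf α⟩
  map_add' α β := IsPullback.unique hf (α := α + β)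
    (fun _ _ _ _ hl => pullsBackOn_pullbackTuple hf (α + β) hl)
    (fun _ _ _ _ hl => (pullsBackOn_pullbackTuple hf α hl).add (pullsBackOn_pullbackTuple hf β hl))
  map_smul' c α := IsPullback.unique hf (α := c • α)
    (fun _ _ _ _ hl => pullsBackOn_pullbackTuple hf (c • α) hl)
    (fun _ _ _ _ hl => (pullsBackOn_pullbackTuple hf α hl).smul c)

theorem isPullback_pullback {f : X → Y} (hf : IsSmooth Q R f) {k : ℕ} (α : R.Form k) :
    IsPullback Q R f α (pullback hf k α) :=
  fun _ _ _ _ hl => pullsBackOn_pullbackTuple hf α hl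

theorem d_pullback {f : X → Y} (hf : IsSmooth Q R f) {k : ℕ} (α : R.Form k) :
    Q.d k (pullback hf k α) = pullback hf (k + 1) (R.d k α) :=
  IsPullback.unique hf (isPullback_pullback hf α).d (isPullback_pullback hf _)

theorem pullback_mem_exact {f : X → Y} (hf : IsSmooth Q R f) {k : ℕ} {α : R.Form k}
    (hα : α ∈ R.Exact k) : pullback hf k α ∈ Q.Exact k := by
  cases k with
  | zero =>
    have h : α = 0 := hα
    rw [h, map_zero]
    exact zero_mem _
  | succ k =>
    obtain ⟨β, rfl⟩ := hα
    exact ⟨pullback hf k β, d_pullback hf β⟩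

/-- The pullback of closed forms along a smooth map. -/
def pullbackClosed {f : X → Y} (hf : IsSmooth Q R f) (k : ℕ) : R.Closed k →ₗ[ℝ] Q.Closed k :=
  (pullback hf k).restrict fun α hα => by
    rw [Closed, LinearMap.mem_ker] at hα ⊢
    rw [d_pullback, hα, map_zero]

/-- The map in de Rham cohomology induced by a smooth map. -/
def pullbackDeRham {f : X → Y} (hf : IsSmooth Q R f) (k : ℕ) : R.DeRham k →ₗ[ℝ] Q.DeRham k :=
  Submodule.mapQ _ _ (pullbackClosed hf k) fun _ hα => pullback_mem_exact hf hα

/-- Equality holds already for forms: the iterated pullback satisfies the condition that determines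
the pullback along `g ∘ f`. -/
theorem pullbackDeRham_comp [FiniteDimensional ℝ F] {f : X → Y} {g : Y → Z}
    (hf : IsSmooth Q R f) (hg : IsSmooth R S g) {k : ℕ} (a : S.DeRham k) :
    pullbackDeRham hf k (pullbackDeRham hg k a) = pullbackDeRham (hg.comp hf) k a := by
  obtain ⟨α, rfl⟩ := Submodule.mkQ_surjective _ a
  refine congrArg (Q.cls k) (Subtype.ext ?_)
  exact IsPullback.unique (hg.comp hf)
    ((isPullback_pullback hf _).comp hf hg (isPullback_pullback hg _)) (isPullback_pullback _ _)

theorem pullbackDeRham_id {k : ℕ} (a : Q.DeRham k) :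
    pullbackDeRham (isSmooth_id Q) k a = a := by
  obtain ⟨α, rfl⟩ := Submodule.mkQ_surjective _ a
  refine congrArg (Q.cls k) (Subtype.ext ?_)
  exact IsPullback.unique (isSmooth_id Q) (isPullback_pullback _ _) (isPullback_id _)

end Pullback

end Quasifold

end

/-! ### Integration along ℝ and comparison of the slices of `X × ℝ`. -/

noncomputable section

/-- The map `D × id` fixes the unit vector of ℝ and is `D` on `E`. -/
theorem contractTime_compContinuousLinearMap {E F : Type*} [NormedAddCommGroup E]
    [NormedSpace ℝ E] [NormedAddCommGroup F] [NormedSpace ℝ F] {k : ℕ}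
    (a : (F × ℝ) [⋀^Fin (k + 1)]→L[ℝ] ℝ) (D : E →L[ℝ] F) :
    contractTime E k (a.compContinuousLinearMap (D.prodMap (ContinuousLinearMap.id ℝ ℝ))) =
      (contractTime F k a).compContinuousLinearMap D := by
  ext v
  rw [contractTime_apply, ContinuousAlternatingMap.compContinuousLinearMap_apply,
    ContinuousAlternatingMap.compContinuousLinearMap_apply, contractTime_apply]
  congr 1
  funext i
  refine Fin.cases ?_ (fun i => ?_) i <;> simp

namespace Quasifold

section TimeIntegral

variable {E : Type*} [NormedAddCommGroup E] [NormedSpace ℝ E]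
  {X : Type*} [TopologicalSpace X] (Q : Quasifold E X)

/-- The product of a manifold modelled on `E` with the real line is modelled on `E × ℝ`. -/
instance prodRealChartedSpace (M : Type*) [TopologicalSpace M] [ChartedSpace E M] :
    ChartedSpace (E × ℝ) (M × ℝ) :=
  prodChartedSpace E M ℝ ℝ

/-- The chart `e × id` of `Cov i × ℝ` induced by a chart `e` of `Cov i`. -/
def prodChart {i : Q.Idx} (e : atlas E (Q.Cov i)) : atlas (E × ℝ) (Q.prodReal.Cov i) :=
  ⟨e.1.prod (OpenPartialHomeomorph.refl ℝ), e.1, e.2, OpenPartialHomeomorph.refl ℝ,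
    mem_singleton _, rfl⟩

theorem isLocalLift_prodMap {i i' : Q.Idx} {W : Set (Q.Cov i)} {m : Q.Cov i → Q.Cov i'}
    (hm : IsLocalLift Q Q id i i' W m) :
    IsLocalLift Q.prodReal Q.prodReal id i i' (W ×ˢ univ : Set (Q.Cov i × ℝ))
      (Prod.map m (id : ℝ → ℝ)) where
  isOpen := hm.isOpen.prod isOpen_univ
  smooth := by
    rw [modelWithCornersSelf_prod]
    exact hm.smooth.prodMap contMDiffOn_id
  lift z hz := Prod.ext (hm.lift z.1 hz.1) rfl

theorem isSmooth_fst : IsSmooth Q.prodReal Q Prod.fst := fun i x =>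
  ⟨i, univ, fun p => p.1, mem_univ x, isOpen_univ, by
    rw [modelWithCornersSelf_prod]
    exact contMDiff_fst.contMDiffOn, fun _ _ => rfl⟩

theorem isLocalLift_slice (t : ℝ) (i : Q.Idx) :
    IsLocalLift Q Q.prodReal (fun p => (p, t)) i i univ (fun x => (x, t)) where
  isOpen := isOpen_univ
  smooth := by
    rw [modelWithCornersSelf_prod]
    exact (contMDiff_id.prodMk contMDiff_const).contMDiffOn
  lift _ _ := rfl

theorem isSmooth_slice (t : ℝ) : IsSmooth Q Q.prodReal fun p => (p, t) := fun i x =>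
  ⟨i, univ, _, mem_univ x, Q.isLocalLift_slice t i⟩

open Classical in
/-- Integration over `[0, 1]` of the contraction of a form with the unit vector field of `ℝ`. -/
def timeIntegralTuple {k : ℕ} (η : Q.prodReal.FormTuple (k + 1)) : Q.FormTuple k :=
  fun i e y => if y ∈ e.1.target then
    ∫ t in (0 : ℝ)..1, contractTime E k (η i (Q.prodChart e) (y, t)) else 0

/-- The projection `X × ℝ → X` is a smooth homotopy equivalence. -/
theorem isSmoothHomotopyEquiv_fst (Q : Quasifold E X) :
    IsSmoothHomotopyEquiv Q.prodReal Q Prod.fst := by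
  -- The homotopy ((x, t), s) ↦ (x, st) joins the projection to the zero slice with the identity.
  -- The other composite is the identity of `X`, so the constant homotopy serves.
  refine ⟨Q.isSmooth_fst, fun p => (p, 0), Q.isSmooth_slice 0,
    ⟨fun p => (p.1.1, p.2 * p.1.2), fun i x => ?_, fun p => ?_, fun p => ?_⟩,
    ⟨Prod.fst, Q.isSmooth_fst, fun _ => rfl, fun _ => rfl⟩⟩
  · refine ⟨i, univ, fun p => (p.1.1, p.2 * p.1.2), mem_univ x, isOpen_univ, ?_, fun _ _ => rfl⟩
    rw [modelWithCornersSelf_prod, modelWithCornersSelf_prod]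
    refine ContMDiff.contMDiffOn ?_
    exact (contMDiff_fst.comp contMDiff_fst).prodMk
      (contMDiff_snd.smul (contMDiff_snd.comp contMDiff_fst))
  · exact Prod.ext rfl (zero_mul _)
  · exact Prod.ext rfl (one_mul _)

variable {Q}

/-- In the charts `e` and `e × id` the slice reads y ↦ (y, t), with derivative the inclusion of `E`.
-/
theorem IsPullback.slice_apply {t : ℝ} {k : ℕ} {η : Q.prodReal.Form k} {ζ : Q.Form k}
    (h : IsPullback Q Q.prodReal (fun p => (p, t)) η ζ) {i : Q.Idx} {e : atlas E (Q.Cov i)}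
    {y : E} (hy : y ∈ e.1.target) :
    ζ.1 i e y = (η.1 i (Q.prodChart e) (y, t)).compContinuousLinearMap
      (ContinuousLinearMap.inl ℝ E ℝ) := by
  have h1 := h i i univ _ (Q.isLocalLift_slice t i) e (Q.prodChart e) y hy (mem_univ _)
    ⟨e.1.map_target hy, mem_univ _⟩
  have h2 : HasFDerivAt (fun z => (Q.prodChart e).1 (e.1.symm z, t))
      (ContinuousLinearMap.inl ℝ E ℝ) y := by
    refine (hasFDerivAt_prodMk_left y t).congr_of_eventuallyEq ?_
    filter_upwards [e.1.open_target.mem_nhds hy] with z hz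
    exact Prod.ext (e.1.right_inv hz) rfl
  have h3 : (Q.prodChart e).1 (e.1.symm y, t) = (y, t) := Prod.ext (e.1.right_inv hy) rfl
  rw [h1, h2.fderiv, h3]

theorem extDeriv_eq_zero_of_closed {k : ℕ} {η : Q.Form k} (hη : Q.d k η = 0) {i : Q.Idx}
    {e : atlas E (Q.Cov i)} {y : E} (hy : y ∈ e.1.target) : extDeriv (η.1 i e) y = 0 := by
  have h : (Q.d k η).1 i e y = 0 := by rw [hη]; rfl
  exact (if_pos hy : (Q.d k η).1 i e y = _).symm.trans h

variable [FiniteDimensional ℝ E]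

theorem Form.pullsBackOn_of_isLocalLift {k : ℕ} {η : Q.FormTuple k} (hη : η ∈ Q.Form k)
    {i i' : Q.Idx} {W : Set (Q.Cov i)} {m : Q.Cov i → Q.Cov i'}
    (hm : IsLocalLift Q Q id i i' W m) : PullsBackOn m W (η i') (η i) :=
  pullsBackOn_of_isLocalLift_id (isSmooth_id Q) ⟨η, hη⟩
    (fun _ _ _ _ hl => isPullback_id (⟨η, hη⟩ : Q.Form k) _ _ _ _ hl) hm

theorem contDiffOn_timeIntegralTuple {k : ℕ} {η : Q.prodReal.FormTuple (k + 1)}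
    (hη : η ∈ Q.prodReal.Form (k + 1)) {i : Q.Idx} (e : atlas E (Q.Cov i)) :
    ContDiffOn ℝ ∞ (Q.timeIntegralTuple η i e) e.1.target :=
  (contDiffOn_integral e.1.open_target (G := fun p => contractTime E k (η i (Q.prodChart e) p))
    ((contractTime E k).contDiff.comp_contDiffOn ((hη.1 i).1 (Q.prodChart e)))).congr
    fun _ hy => if_pos hy

/-- The map `m × id` lifts the identity of `X × ℝ`, so it pulls η back to itself. Contraction
commutes with its derivative `D × id`, and pullback along `D`, being continuous and linear, passes
through the integral. -/
theorem pullsBackOn_timeIntegralTuple {k : ℕ} {η : Q.prodReal.FormTuple (k + 1)}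
    (hη : η ∈ Q.prodReal.Form (k + 1)) {i i' : Q.Idx} {W : Set (Q.Cov i)}
    {m : Q.Cov i → Q.Cov i'} (hm : IsLocalLift Q Q id i i' W m) :
    PullsBackOn m W (Q.timeIntegralTuple η i') (Q.timeIntegralTuple η i) := by
  intro e e' y hy hyW hs
  have hs' : e'.1 (m (e.1.symm y)) ∈ e'.1.target := e'.1.map_source hs
  have h1 := Form.pullsBackOn_of_isLocalLift hη (Q.isLocalLift_prodMap hm)
  have hD := ((contDiffAt_chart_comp_symm hm.isOpen hm.smooth hy hyW hs).differentiableAt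
    (by simp)).hasFDerivAt
  set D := fderiv ℝ (fun z => e'.1 (m (e.1.symm z))) y
  have h2 : ∀ t : ℝ, contractTime E k (η i (Q.prodChart e) (y, t)) =
      (contractTime E k (η i' (Q.prodChart e')
        (e'.1 (m (e.1.symm y)), t))).compContinuousLinearMap D := by
    intro t
    have h3 := h1 (Q.prodChart e) (Q.prodChart e') (y, t) ⟨hy, mem_univ _⟩ ⟨hyW, mem_univ _⟩
      ⟨hs, mem_univ _⟩
    have h4 : HasFDerivAt (fun z : E × ℝ => (Q.prodChart e').1
        (Prod.map m (id : ℝ → ℝ) ((Q.prodChart e).1.symm z)))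
        (D.prodMap (ContinuousLinearMap.id ℝ ℝ)) (y, t) :=
      HasFDerivAt.prodMap (y, t) hD (hasFDerivAt_id t)
    rw [h3, h4.fderiv, contractTime_compContinuousLinearMap]
    rfl
  have hcont : Continuous fun t : ℝ => contractTime E k (η i' (Q.prodChart e')
      (e'.1 (m (e.1.symm y)), t)) :=
    (contractTime E k).continuous.comp (((hη.1 i').1 (Q.prodChart e')).continuousOn.comp_continuous
      (by fun_prop) fun t => ⟨hs', mem_univ t⟩)
  have h5 : Q.timeIntegralTuple η i e y = _ := if_pos hy
  have h6 : Q.timeIntegralTuple η i' e' (e'.1 (m (e.1.symm y))) = _ := if_pos hs'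
  rw [h5, h6]
  simp only [h2]
  exact intervalIntegral_clm_comm
    (ContinuousAlternatingMap.compContinuousLinearMapCLM (ι := Fin k) (F := ℝ) D) hcont

theorem timeIntegralTuple_mem {k : ℕ} {η : Q.prodReal.FormTuple (k + 1)}
    (hη : η ∈ Q.prodReal.Form (k + 1)) : Q.timeIntegralTuple η ∈ Q.Form k :=
  ⟨fun _ => ⟨contDiffOn_timeIntegralTuple hη, fun _ _ hy => if_neg hy,
      pullsBackOn_timeIntegralTuple hη ⟨isOpen_univ, contMDiffOn_id, fun _ _ => rfl⟩⟩,
    fun i γ => pullsBackOn_timeIntegralTuple hη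
      ⟨isOpen_univ, (Q.smooth_smul i γ).contMDiffOn, fun z _ => proj_smul i γ z⟩,
    fun _ _ h h1 _ h3 => pullsBackOn_timeIntegralTuple hη ⟨h.open_source, h1, h3⟩⟩

/-- The restrictions of a closed form on `X × ℝ` to `X × {1}` and `X × {0}` differ by an exact
form. -/
theorem pullback_slice_sub_mem_exact {k : ℕ} {η : Q.prodReal.Form k} (hη : Q.prodReal.d k η = 0) :
    pullback (Q.isSmooth_slice 1) k η - pullback (Q.isSmooth_slice 0) k η ∈ Q.Exact k := by
  have happ : ∀ (t : ℝ) {i : Q.Idx} (e : atlas E (Q.Cov i)) {y : E}, y ∈ e.1.target →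
      (pullback (Q.isSmooth_slice t) k η).1 i e y =
        (η.1 i (Q.prodChart e) (y, t)).compContinuousLinearMap (ContinuousLinearMap.inl ℝ E ℝ) :=
    fun t i e y hy => (isPullback_pullback (Q.isSmooth_slice t) η).slice_apply hy
  have hd : ∀ {l : Q.Idx} (e : atlas E (Q.Cov l)), ∀ p ∈ e.1.target ×ˢ (univ : Set ℝ),
      extDeriv (η.1 l (Q.prodChart e)) p = 0 := fun e p hp =>
    extDeriv_eq_zero_of_closed hη (e := Q.prodChart e) hp
  cases k with
  | zero =>
    -- In degree 0 the only exact form is 0, so the two slices must agree outright.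
    refine sub_eq_zero.2 ?_
    ext1
    funext i e y
    by_cases hy : y ∈ e.1.target
    · rw [happ 1 e hy, happ 0 e hy, eq_of_extDeriv_eq_zero e.1.open_target
        ((η.2.1 i).1 (Q.prodChart e)) (hd e) hy 1 0]
    · rw [((pullback (Q.isSmooth_slice 1) 0 η).2.1 i).2.1 e y hy,
        ((pullback (Q.isSmooth_slice 0) 0 η).2.1 i).2.1 e y hy]
  | succ k =>
    -- The primitive is the integral over `[0, 1]` of the contraction of η with ∂/∂t.
    refine ⟨⟨Q.timeIntegralTuple η.1, timeIntegralTuple_mem η.2⟩, ?_⟩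
    refine eq_sub_of_add_eq ?_
    ext1
    funext i e y
    change FormFamily.d (Q.timeIntegralTuple η.1 i) e y +
      (pullback (Q.isSmooth_slice 0) (k + 1) η).1 i e y = _
    by_cases hy : y ∈ e.1.target
    · have hev : Q.timeIntegralTuple η.1 i e =ᶠ[𝓝 y] fun z =>
          ∫ t in (0 : ℝ)..1, contractTime E k (η.1 i (Q.prodChart e) (z, t)) := by
        filter_upwards [e.1.open_target.mem_nhds hy] with z hz
        exact if_pos hz
      rw [FormFamily.d, if_pos hy, happ 1 e hy, happ 0 e hy, hev.extDeriv_eq,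
        extDeriv_integral_contractTime e.1.open_target ((η.2.1 i).1 (Q.prodChart e)) (hd e) hy,
        sub_add_cancel]
    · rw [((pullback (Q.isSmooth_slice 1) (k + 1) η).2.1 i).2.1 e y hy,
        ((pullback (Q.isSmooth_slice 0) (k + 1) η).2.1 i).2.1 e y hy, FormFamily.d, if_neg hy,
        add_zero]

theorem pullbackDeRham_slice {k : ℕ} (a : Q.prodReal.DeRham k) :
    pullbackDeRham (Q.isSmooth_slice 1) k a = pullbackDeRham (Q.isSmooth_slice 0) k a := by
  obtain ⟨η, rfl⟩ := Submodule.mkQ_surjective _ a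
  exact (Submodule.Quotient.eq _).2 (pullback_slice_sub_mem_exact η.2)

end TimeIntegral

/-! ### Homotopy invariance of de Rham cohomology. -/

section HomotopyInvariance

variable {E F : Type*} [NormedAddCommGroup E] [NormedSpace ℝ E] [FiniteDimensional ℝ E]
  [NormedAddCommGroup F] [NormedSpace ℝ F]
  {X Y : Type*} [TopologicalSpace X] [TopologicalSpace Y]
  {Q : Quasifold E X} {R : Quasifold F Y}

/-- Homotopic smooth maps induce the same map in de Rham cohomology. -/
theorem SmoothHomotopic.pullbackDeRham_eq {f g : X → Y} (h : SmoothHomotopic Q R f g)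
    (hf : IsSmooth Q R f) (hg : IsSmooth Q R g) {k : ℕ} (a : R.DeRham k) :
    pullbackDeRham hf k a = pullbackDeRham hg k a := by
  obtain ⟨H, hH, h0, h1⟩ := h
  -- Both ends of the homotopy factor through `H`, so functoriality reduces the claim to the two
  -- slices.
  obtain rfl : (H ∘ fun p => (p, 0)) = f := funext h0
  obtain rfl : (H ∘ fun p => (p, 1)) = g := funext h1
  rw [← pullbackDeRham_comp (Q.isSmooth_slice 0) hH, ← pullbackDeRham_comp (Q.isSmooth_slice 1) hH,
    pullbackDeRham_slice]

variable [FiniteDimensional ℝ F]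

/-- The isomorphism in de Rham cohomology induced by a smooth homotopy equivalence. -/
theorem IsSmoothHomotopyEquiv.exists_equiv {f : X → Y} (hf : IsSmoothHomotopyEquiv Q R f) (k : ℕ) :
    ∃ Φ : R.DeRham k ≃ₗ[ℝ] Q.DeRham k, ∀ a, Φ a = pullbackDeRham hf.1 k a := by
  obtain ⟨hf, g, hg, hgf, hfg⟩ := hf
  refine ⟨LinearEquiv.ofLinearMap (pullbackDeRham hf k) (pullbackDeRham hg k)
    (LinearMap.ext fun a => ?_) (LinearMap.ext fun a => ?_), fun _ => rfl⟩
  · change pullbackDeRham hf k (pullbackDeRham hg k a) = a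
    rw [pullbackDeRham_comp hf hg, hgf.pullbackDeRham_eq _ (isSmooth_id Q), pullbackDeRham_id]
  · change pullbackDeRham hg k (pullbackDeRham hf k a) = a
    rw [pullbackDeRham_comp hg hf, hfg.pullbackDeRham_eq _ (isSmooth_id R), pullbackDeRham_id]

theorem IsSmoothHomotopyEquiv.pullbackIsIso {f : X → Y} (hf : IsSmoothHomotopyEquiv Q R f)
    (k : ℕ) : PullbackIsIso Q R f k := by
  obtain ⟨Φ, hΦ⟩ := hf.exists_equiv k
  exact ⟨Φ, fun α => ⟨pullbackClosed hf.1 k α, isPullback_pullback hf.1 α.1, hΦ _⟩⟩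

end HomotopyInvariance

end Quasifold

end

theorem mainTheorem2 {E F : Type*} [NormedAddCommGroup E] [NormedSpace ℝ E] [FiniteDimensional ℝ E]
    [NormedAddCommGroup F] [NormedSpace ℝ F] [FiniteDimensional ℝ F]
    {X Y : Type*} [TopologicalSpace X] [TopologicalSpace Y]
    (Q : Quasifold E X) (R : Quasifold F Y) :
    -- Poincaré lemma: the projection `X × ℝ → X` induces `H^k(X) ≅ H^k(X × ℝ)`
    (Quasifold.IsSmooth Q.prodReal Q Prod.fst ∧
      ∀ k : ℕ, Quasifold.PullbackIsIso Q.prodReal Q Prod.fst k) ∧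
    -- every smooth homotopy equivalence `f : X → Y` induces `H^k(Y) ≅ H^k(X)`
    (∀ f : X → Y, Quasifold.IsSmoothHomotopyEquiv Q R f →
      ∀ k : ℕ, Quasifold.PullbackIsIso Q R f k) ∧
    -- quasifolds of the same smooth homotopy type have isomorphic cohomology
    (Quasifold.SameSmoothHomotopyType Q R → ∀ k : ℕ, Nonempty (Q.DeRham k ≃ₗ[ℝ] R.DeRham k)) := by
  refine ⟨⟨Q.isSmooth_fst, (Quasifold.isSmoothHomotopyEquiv_fst Q).pullbackIsIso⟩,
    fun f hf => hf.pullbackIsIso, ?_⟩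
  rintro ⟨f, hf⟩ k
  obtain ⟨Φ, -⟩ := hf.exists_equiv k
  exact ⟨Φ.symm⟩
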